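/- Let $G$ be a finite simple graph. For a vertex $v$ of a graph $H$ let $\mathrm{cl}_H(v)$ be the maximum of $|N_H(u)\cap N_H(v)|$ over all vertices $u\neq v$ of $H$ that are not adjacent to $v$ (and $0$ if there is no such $u$). The \emph{weak closure} $\gamma(G)$ is the smallest integer $\gamma\ge 0$ such that every nonempty induced subgraph $G'$ of $G$ has a vertex $v$ with $\mathrm{cl}_{G'}(v)<\gamma$. Consider the following two decision problems. \textsc{Non-Induced $(k_1,k_2)$-Biclique}: given a graph $G$ and $k_1,k_2\in\mathbb{N}$, are there disjoint vertex sets $S,T\subseteq V(G)$ with $|S|\ge k_1$, $|T|\ge k_2$ and $st\in E(G)$ for all $s\in S$, $t\in T$? \textsc{Non-Induced Max-Edge Biclique}: given a graph $G$ and $k\in\mathbb{N}$, are there disjoint vertex sets $S,T\subseteq V(G)$ with $|S|\cdot|T|\ge k$ and $st\in E(G)$ for all $s\in S$, $t\in T$? \textbf{Theorem.} Both problems can be solved in $\mathcal{O}^*(2^{\gamma(G)})$ time. That is, for each of them there are a single random access machine program (unit cost per step, with successor and predecessor as the only arithmetic) and a polynomial $q$ such that, on every instance $I$ with graph $G$ (given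 by its adjacency matrix), the program halts with the correct yes/no answer after at most $2^{\gamma(G)}\cdot q(|I|)$ steps, where $|I|$ is the size of $I$ in bits. The value $\gamma(G)$ is not part of the input. -/

import Mathlib

/-! ### A random access machine

Unit-cost random access machine with structured control flow. It has registers `0, 1, 2, …` and
memory arrays `0, 1, 2, …` with indirect addressing, all cells holding natural numbers; a program
mentions only finitely many registers and arrays. The only arithmetic is successor and predecessor,
so a run of `t` steps creates no number above (largest number in the input or the program) + `t`:
the unit-cost measure cannot be abused by building long numbers in few steps. -/

namespace RAM

/-- A memory state: contents of the registers, and of the arrays (array name, then index). -/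
structure State where
  reg : ℕ → ℕ
  arr : ℕ → ℕ → ℕ

/-- Set register `x` to `v`. -/
def State.setReg (σ : State) (x v : ℕ) : State :=
  { σ with reg := Function.update σ.reg x v }

/-- Set cell `i` of array `a` to `v`. -/
def State.setArr (σ : State) (a i v : ℕ) : State :=
  { σ with arr := Function.update σ.arr a (Function.update (σ.arr a) i v) }

/-- Tests comparing two registers. -/
inductive Test where
  | eq (x y : ℕ)
  | lt (x y : ℕ)

/-- The truth value of a test. -/
def Test.Holds : Test → State → Prop
  | .eq x y, σ => σ.reg x = σ.reg y
  | .lt x y, σ => σ.reg x < σ.reg y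

/-- Programs; the arguments are names of registers, except for the constant `c` in `const` and the
array names `a` in `load` and `store`. -/
inductive Cmd where
  | skip
  /-- `x := c` -/
  | const (x c : ℕ)
  /-- `x := y` -/
  | copy (x y : ℕ)
  /-- `x := x + 1` -/
  | inc (x : ℕ)
  /-- `x := max (x - 1) 0` -/
  | dec (x : ℕ)
  /-- `x := a[y]` -/
  | load (x a y : ℕ)
  /-- `a[x] := y` -/
  | store (a x y : ℕ)
  | seq (p q : Cmd)
  | ite (b : Test) (p q : Cmd)
  | loop (b : Test) (p : Cmd)

/-- `Exec p σ t σ'`: the program `p`, started in `σ`, halts in `σ'` after exactly `t` steps. Every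
elementary command and every evaluation of a test takes one step; `loop b p` is
"while `b` do `p`". -/
inductive Exec : Cmd → State → ℕ → State → Prop where
  | skip (σ : State) : Exec .skip σ 1 σ
  | const (x c : ℕ) (σ : State) : Exec (.const x c) σ 1 (σ.setReg x c)
  | copy (x y : ℕ) (σ : State) : Exec (.copy x y) σ 1 (σ.setReg x (σ.reg y))
  | inc (x : ℕ) (σ : State) : Exec (.inc x) σ 1 (σ.setReg x (σ.reg x + 1))
  | dec (x : ℕ) (σ : State) : Exec (.dec x) σ 1 (σ.setReg x (σ.reg x - 1))
  | load (x a y : ℕ) (σ : State) : Exec (.load x a y) σ 1 (σ.setReg x (σ.arr a (σ.reg y)))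
  | store (a x y : ℕ) (σ : State) :
      Exec (.store a x y) σ 1 (σ.setArr a (σ.reg x) (σ.reg y))
  | seq {p q : Cmd} {σ σ₁ σ₂ : State} {s t : ℕ} :
      Exec p σ s σ₁ → Exec q σ₁ t σ₂ → Exec (.seq p q) σ (s + t) σ₂
  | ite_true {b : Test} {p q : Cmd} {σ σ₁ : State} {t : ℕ} :
      b.Holds σ → Exec p σ t σ₁ → Exec (.ite b p q) σ (1 + t) σ₁
  | ite_false {b : Test} {p q : Cmd} {σ σ₁ : State} {t : ℕ} :
      ¬ b.Holds σ → Exec q σ t σ₁ → Exec (.ite b p q) σ (1 + t) σ₁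
  | loop_true {b : Test} {p : Cmd} {σ σ₁ σ₂ : State} {s t : ℕ} :
      b.Holds σ → Exec p σ s σ₁ → Exec (.loop b p) σ₁ t σ₂ → Exec (.loop b p) σ (1 + s + t) σ₂
  | loop_false {b : Test} {p : Cmd} {σ : State} :
      ¬ b.Holds σ → Exec (.loop b p) σ 1 σ

/-- Started in `σ`, the program `p` halts after at most `T` steps with the correct answer to the
yes/no question `answer` in register `0` (`1` for yes, `0` for no). -/
def DecidesWithin (p : Cmd) (σ : State) (T : ℕ) (answer : Prop) : Prop :=
  ∃ (t : ℕ) (σ' : State), Exec p σ t σ' ∧ t ≤ T ∧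
    (answer → σ'.reg 0 = 1) ∧ (¬ answer → σ'.reg 0 = 0)

open Classical in
/-- The initial state encoding a graph on `n` vertices followed by a list of numbers: register `0`
holds `n`, registers `1, 2, …` hold the numbers, array `0` holds the adjacency matrix row by row,
and every other cell is `0`. -/
noncomputable def graphInput {n : ℕ} (G : SimpleGraph (Fin n)) (ks : List ℕ) : State where
  reg := fun i => (n :: ks).getD i 0
  arr := fun a m => if a = 0 ∧ ∃ i j : Fin n, m = (i : ℕ) * n + j ∧ G.Adj i j then 1 else 0

/-- The size (in bits) of such an input: the adjacency matrix and the numbers in binary. -/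
def inputSize (n : ℕ) (ks : List ℕ) : ℕ :=
  n * n + Nat.size n + (ks.map Nat.size).sum

end RAM

/-! ### Weak closure and non-induced bicliques -/

/-- The closure number of a vertex `v` of a finite graph: the maximum of `|N(v) ∩ N(u)|` over all
`u ≠ v` not adjacent to `v`, and `0` if there is no such `u`. -/
noncomputable def closureNumber {V : Type*} (G : SimpleGraph V) (v : V) : ℕ :=
  sSup {m | ∃ u, u ≠ v ∧ ¬ G.Adj v u ∧ m = (G.commonNeighbors v u).ncard}

/-- `G` is weakly `g`-closed: every (nonempty) induced subgraph has a vertex whose closure number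
in that subgraph is less than `g`. -/
def IsWeaklyClosed {V : Type*} (G : SimpleGraph V) (g : ℕ) : Prop :=
  ∀ X : Set V, X.Nonempty → ∃ v : X, closureNumber (G.induce X) v < g

/-- The weak closure of a finite graph: the least `g` such that it is weakly `g`-closed. -/
noncomputable def weakClosure {V : Type*} (G : SimpleGraph V) : ℕ :=
  sInf {g | IsWeaklyClosed G g}

/-- Some disjoint `S` and `T`, completely joined to each other, have `|S| ≥ k₁` and `|T| ≥ k₂`. -/
def HasNonInducedBiclique {V : Type*} (G : SimpleGraph V) (k₁ k₂ : ℕ) : Prop :=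
  ∃ S T : Finset V, Disjoint S T ∧ k₁ ≤ S.card ∧ k₂ ≤ T.card ∧ ∀ s ∈ S, ∀ t ∈ T, G.Adj s t

/-- Some disjoint `S` and `T`, completely joined to each other, have `|S| * |T| ≥ k`. -/
def HasNonInducedMaxEdgeBiclique {V : Type*} (G : SimpleGraph V) (k : ℕ) : Prop :=
  ∃ S T : Finset V, Disjoint S T ∧ k ≤ S.card * T.card ∧ ∀ s ∈ S, ∀ t ∈ T, G.Adj s t

/-! Write γ for the weak closure. Repeatedly removing a vertex of least closure number, and placing
it last among the vertices still present, orders the vertices so that each `v` has, among the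
vertices not after it, fewer than γ common neighbours with each earlier non-neighbour `u`
(`orderProg_spec`). Hence for such a pair the candidate set, `v` together with the common neighbours
of `u` and `v` not after `v`, has at most γ elements (`IsElim.card_candidates`) and at most 2^γ
subsets.

Consider a biclique `(S, T)` in a prefix of the order whose last vertex `v` lies in `S`. If some
earlier non-neighbour `u` of `v` is adjacent to all of `T`, then `T` is a set of candidates.
Otherwise `v` is adjacent to the rest of `S`, since a non-neighbour of `v` in `S` would be such a
`u`; so if some earlier non-neighbour is adjacent to all of `S` except `v`, then `S` is a set of
candidates. In both cases one side is a subset of a small set, and the other side may be replaced by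
all common neighbours of the first up to `v`. In the remaining case every earlier non-neighbour of
`v` misses a vertex on each side. A labelling that covers the biclique without `v` then has no
labelled non-neighbour of `v`: such a vertex would have to be on the side of the vertex it misses in
`S` and also on the side of the one it misses in `T`. So `v` is adjacent to everything labelled and
may be put on either side. By induction (`exists_covers`), every biclique is covered by a labelling
that arises from the empty one, or from a pair `(v, u)` and a subset of its candidates, by one
greedy pass that gives label `3` to each vertex adjacent to everything labelled.

Vertices labelled `3` are interchangeable, so only their number on each side matters, and `n + 1`
thresholds suffice (`Covers.exists_threshold`). Both problems ask for a monotone, symmetric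
condition on the two sizes, so `exists_biclique_iff` treats them together. Subsets of candidates are
encoded by bit masks. The mask length is the largest candidate number, which is computed, so γ need
not be known.

Everything polynomial is written in a language whose loops have length `n` and whose translation has
a polynomial running time by construction (`Prog.runs_compile`). The only other loop runs through
the masks (`bicliqueCmd_spec`). -/

namespace RAM

/-! ### Expressions and loop programs

A small language of expressions and of programs whose loops all run `n` times, where `n` is the
content of register `0`, and its translation to the random access machine. -/

/-- Two states with the same arrays and the same contents of the registers below `d`. -/
def Agree (d : ℕ) (σ τ : State) : Prop :=
  σ.arr = τ.arr ∧ ∀ y < d, σ.reg y = τ.reg y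

theorem Agree.refl (d : ℕ) (σ : State) : Agree d σ σ := ⟨rfl, fun _ _ => rfl⟩

theorem Agree.trans {d : ℕ} {σ τ υ : State} (h : Agree d σ τ) (h' : Agree d τ υ) :
    Agree d σ υ :=
  ⟨h.1.trans h'.1, fun y hy => (h.2 y hy).trans (h'.2 y hy)⟩

theorem Agree.mono {d e : ℕ} {σ τ : State} (h : Agree e σ τ) (hd : d ≤ e) : Agree d σ τ :=
  ⟨h.1, fun y hy => h.2 y (hy.trans_le hd)⟩

@[simp] theorem State.setReg_arr (σ : State) (x v : ℕ) : (σ.setReg x v).arr = σ.arr := rfl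

@[simp] theorem State.setArr_reg (σ : State) (a i v : ℕ) : (σ.setArr a i v).reg = σ.reg := rfl

theorem State.setReg_reg (σ : State) (x v y : ℕ) :
    (σ.setReg x v).reg y = if y = x then v else σ.reg y := by
  simp [State.setReg, Function.update_apply]

theorem State.setArr_arr (σ : State) (a i v b j : ℕ) :
    (σ.setArr a i v).arr b j = if b = a ∧ j = i then v else σ.arr b j := by
  by_cases h : b = a
  · subst h; simp [State.setArr, Function.update_apply]
  · simp [State.setArr, h]

theorem Agree.setReg {d : ℕ} {σ τ : State} (h : Agree d σ τ) (x v : ℕ) :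
    Agree d (σ.setReg x v) (τ.setReg x v) := by
  refine ⟨h.1, fun y hy => ?_⟩
  simp only [State.setReg_reg, h.2 y hy]

theorem Agree.setReg_right {d : ℕ} {σ τ : State} (h : Agree d σ τ) {x : ℕ} (hx : d ≤ x) (v : ℕ) :
    Agree d σ (τ.setReg x v) := by
  refine ⟨h.1, fun y hy => ?_⟩
  rw [State.setReg_reg, if_neg (by omega), h.2 y hy]

theorem Agree.setArr {d : ℕ} {σ τ : State} (h : Agree d σ τ) (a i v : ℕ) :
    Agree d (σ.setArr a i v) (τ.setArr a i v) := by
  refine ⟨?_, h.2⟩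
  simp only [State.setArr, h.1]

/-- Expressions. The value of `add e f` is `e + min f n`, and that of `sum x e` is the sum of
`min e n` over all values of register `x` below `n`. -/
inductive Exp where
  | const (c : ℕ)
  | reg (x : ℕ)
  | load (a : ℕ) (e : Exp)
  | succ (e : Exp)
  | add (e f : Exp)
  | iflt (a b e f : Exp)
  | sum (x : ℕ) (e : Exp)

namespace Exp

/-- The value of an expression. -/
def eval : Exp → State → ℕ
  | const c, _ => c
  | reg x, σ => σ.reg x
  | load a e, σ => σ.arr a (e.eval σ)
  | succ e, σ => e.eval σ + 1
  | add e f, σ => e.eval σ + min (f.eval σ) (σ.reg 0)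
  | iflt a b e f, σ => if a.eval σ < b.eval σ then e.eval σ else f.eval σ
  | sum x e, σ => ∑ k ∈ Finset.range (σ.reg 0), min (e.eval (σ.setReg x k)) (σ.reg 0)

/-- All registers mentioned are below `d`, and register `0` is not a bound variable. -/
def wf (d : ℕ) : Exp → Bool
  | const _ => true
  | reg x => decide (x < d)
  | load _ e => e.wf d
  | succ e => e.wf d
  | add e f => e.wf d && f.wf d
  | iflt a b e f => a.wf d && b.wf d && e.wf d && f.wf d
  | sum x e => decide (0 < x) && decide (x < d) && e.wf d

theorem wf_mono {d d' : ℕ} (h : d ≤ d') (e : Exp) : e.wf d → e.wf d' := by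
  induction e with
  | const c => simp [wf]
  | reg x => simp only [wf, decide_eq_true_eq]; omega
  | load a e ih => simpa [wf] using ih
  | succ e ih => simpa [wf] using ih
  | add e f ihe ihf => simp only [wf, Bool.and_eq_true]; tauto
  | iflt a b e f iha ihb ihe ihf => simp only [wf, Bool.and_eq_true]; tauto
  | sum x e ih =>
    simp only [wf, Bool.and_eq_true, decide_eq_true_eq]
    rintro ⟨⟨h1, h2⟩, h3⟩
    exact ⟨⟨h1, by omega⟩, ih h3⟩

theorem eval_congr {d : ℕ} (hd : 0 < d) (e : Exp) (he : e.wf d) {σ τ : State}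
    (h : Agree d σ τ) : e.eval σ = e.eval τ := by
  induction e generalizing σ τ with
  | const c => rfl
  | reg x => exact h.2 x (by simpa [wf] using he)
  | load a e ih => simp only [eval, ih he h, h.1]
  | succ e ih => simp only [eval, ih he h]
  | add e f ihe ihf =>
    simp only [wf, Bool.and_eq_true] at he
    simp only [eval, ihe he.1 h, ihf he.2 h, h.2 0 hd]
  | iflt a b e f iha ihb ihe ihf =>
    simp only [wf, Bool.and_eq_true] at he
    simp only [eval, iha he.1.1.1 h, ihb he.1.1.2 h, ihe he.1.2 h, ihf he.2 h]
  | sum x e ih =>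
    simp only [wf, Bool.and_eq_true] at he
    simp only [eval, h.2 0 hd]
    exact Finset.sum_congr rfl fun k _ => by rw [ih he.2 (h.setReg x k)]

end Exp

/-! ### Running times of loops, and the translation of expressions -/

/-- Add the minimum of registers `r` and `0` to register `x`, with loop counter `i`. -/
def addLoop (x r i : ℕ) : Cmd :=
  .seq (.const i 0) (.loop (.lt i 0) (.seq (.ite (.lt i r) (.inc x) .skip) (.inc i)))

/-- A loop executed for the values `0, …, n - 1` of register `x`. -/
def forLoop (x : ℕ) (p : Cmd) : Cmd :=
  .seq (.const x 0) (.loop (.lt x 0) (.seq p (.inc x)))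

/-- `p` started in `σ` halts within `T` steps in a state satisfying `Q`. -/
def Runs (p : Cmd) (σ : State) (T : ℕ) (Q : State → Prop) : Prop :=
  ∃ t σ', Exec p σ t σ' ∧ t ≤ T ∧ Q σ'

theorem Runs.weaken {p : Cmd} {σ : State} {T T' : ℕ} {Q Q' : State → Prop} (h : Runs p σ T Q)
    (hT : T ≤ T') (hQ : ∀ τ, Q τ → Q' τ) : Runs p σ T' Q' := by
  obtain ⟨t, σ', h1, h2, h3⟩ := h
  exact ⟨t, σ', h1, h2.trans hT, hQ _ h3⟩

theorem Runs.seq {p q : Cmd} {σ : State} {S T : ℕ} {Q R : State → Prop} (h : Runs p σ S R)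
    (h' : ∀ τ, R τ → Runs q τ T Q) : Runs (.seq p q) σ (S + T) Q := by
  obtain ⟨t, σ', h1, h2, h3⟩ := h
  obtain ⟨t', σ'', h4, h5, h6⟩ := h' _ h3
  exact ⟨_, _, .seq h1 h4, by omega, h6⟩

theorem Runs.loop {b : Test} {p : Cmd} {T : ℕ} (I : ℕ → State → Prop) (K : ℕ)
    (hb : ∀ k < K, ∀ τ, I k τ → b.Holds τ) (hK : ∀ τ, I K τ → ¬ b.Holds τ)
    (hp : ∀ k < K, ∀ τ, I k τ → Runs p τ T (I (k + 1))) {σ : State} (h0 : I 0 σ) :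
    Runs (.loop b p) σ (K * (T + 1) + 1) (I K) := by
  suffices H : ∀ m k σ, k + m = K → I k σ → Runs (.loop b p) σ (m * (T + 1) + 1) (I K) from
    H K 0 σ (by omega) h0
  intro m
  induction m with
  | zero =>
    intro k σ hk hI
    obtain rfl : k = K := by omega
    exact ⟨1, σ, .loop_false (hK _ hI), by omega, hI⟩
  | succ m ih =>
    intro k σ hk hI
    obtain ⟨t, σ', h1, h2, h3⟩ := hp k (by omega) σ hI
    obtain ⟨t', σ'', h4, h5, h6⟩ := ih (k + 1) σ' (by omega) h3
    refine ⟨_, _, .loop_true (hb k (by omega) _ hI) h1 h4, ?_, h6⟩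
    rw [add_mul]; omega

theorem Runs.forLoop {p : Cmd} {T : ℕ} {x : ℕ} (I : ℕ → State → Prop) {σ : State} {n : ℕ}
    (hx : ∀ k τ, I k τ → τ.reg x = k) (hn : ∀ k τ, I k τ → τ.reg 0 = n)
    (h0 : I 0 (σ.setReg x 0))
    (hp : ∀ k < n, ∀ τ, I k τ → Runs p τ T (fun τ' => I (k + 1) (τ'.setReg x (τ'.reg x + 1)))) :
    Runs (forLoop x p) σ (n * (T + 2) + 2) (I n) := by
  have h := Runs.loop (b := .lt x 0) (p := .seq p (.inc x)) (T := T + 1) I n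
    (fun k hk τ h => by simp [Test.Holds, hx _ _ h, hn _ _ h, hk])
    (fun τ h => by simp [Test.Holds, hx _ _ h, hn _ _ h])
    (fun k hk τ h => (hp k hk τ h).seq fun τ' h' => ⟨1, _, .inc x τ', le_rfl, h'⟩) h0
  exact (Runs.seq (S := 1) (R := fun τ => τ = σ.setReg x 0) ⟨1, _, .const x 0 σ, le_rfl, rfl⟩
    (fun τ hτ => hτ ▸ h)).weaken (by ring_nf; omega) fun _ h => h

/-- The loop always makes `n` passes, and after `k` of them `x` has grown by the minimum of register
`r` and `k`. This is why operands are capped at `n` throughout. -/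
theorem runs_addLoop {x r i : ℕ} (hx : 0 < x) (hxr : x < r) (hri : r < i) (σ : State) :
    Runs (addLoop x r i) σ (4 * σ.reg 0 + 2) (fun τ =>
      Agree i (σ.setReg x (σ.reg x + min (σ.reg r) (σ.reg 0))) τ) := by
  have h := Runs.loop (b := .lt i 0) (p := .seq (.ite (.lt i r) (.inc x) .skip) (.inc i)) (T := 3)
    (fun k τ => Agree i (σ.setReg x (σ.reg x + min (σ.reg r) k)) τ ∧ τ.reg i = k) (σ.reg 0)
    (fun k hk τ ⟨h, hi⟩ => by
      have := h.2 0 (by omega)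
      rw [State.setReg_reg, if_neg (by omega)] at this
      simp [Test.Holds, hi, ← this, hk])
    (fun τ ⟨h, hi⟩ => by
      have := h.2 0 (by omega)
      rw [State.setReg_reg, if_neg (by omega)] at this
      simp [Test.Holds, hi, ← this])
    (fun k hk τ ⟨h, hi⟩ => by
      have hr := h.2 r (by omega)
      rw [State.setReg_reg, if_neg (by omega)] at hr
      have hx' := h.2 x (by omega)
      rw [State.setReg_reg, if_pos rfl] at hx'
      by_cases hk' : k < σ.reg r
      · refine ⟨_, _, .seq (.ite_true ?_ (.inc x τ)) (.inc i _), by omega, ⟨?_, ?_⟩, ?_⟩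
        · simpa [Test.Holds, hi, ← hr]
        · exact h.1
        · intro y hy
          have := h.2 y hy
          simp only [State.setReg_reg] at this ⊢
          split_ifs at this ⊢ <;> omega
        · simp only [State.setReg_reg]
          rw [if_pos trivial, if_neg (by omega), hi]
      · refine ⟨_, _, .seq (.ite_false ?_ (.skip τ)) (.inc i _), by omega, ⟨?_, ?_⟩, ?_⟩
        · simpa [Test.Holds, hi, ← hr] using hk'
        · exact h.1
        · intro y hy
          have := h.2 y hy
          simp only [State.setReg_reg] at this ⊢
          split_ifs at this ⊢ <;> omega
        · simp only [State.setReg_reg]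
          rw [if_pos trivial, hi])
    (σ := σ.setReg i 0) ⟨⟨rfl, fun y hy => by
      simp only [State.setReg_reg]
      split_ifs <;> first | omega | skip
      subst_vars; simp⟩, by simp [State.setReg_reg]⟩
  exact (Runs.seq (S := 1) (R := fun τ => τ = σ.setReg i 0) ⟨1, _, .const i 0 σ, le_rfl, rfl⟩
    (fun τ hτ => hτ ▸ h)).weaken (by omega) fun _ h => h.1

namespace Exp

/-- Translation of an expression: the value is put into register `d`, and no register below `d`
is changed. -/
def compile : Exp → ℕ → Cmd
  | const c, d => .const d c
  | reg x, d => .copy d x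
  | load a e, d => .seq (e.compile d) (.load d a d)
  | succ e, d => .seq (e.compile d) (.inc d)
  | add e f, d => .seq (e.compile d) (.seq (f.compile (d + 1)) (addLoop d (d + 1) (d + 2)))
  | iflt a b e f, d => .seq (a.compile d) (.seq (b.compile (d + 1))
      (.ite (.lt d (d + 1)) (e.compile d) (f.compile d)))
  | sum x e, d => .seq (.const d 0) (.seq (.copy (d + 1) x)
      (.seq (forLoop x (.seq (e.compile (d + 2)) (addLoop d (d + 2) (d + 3))))
        (.copy x (d + 1))))

open Polynomial in
/-- A bound for the running time of the translation, as a polynomial in `n`. -/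
noncomputable def cost : Exp → Polynomial ℕ
  | const _ => 1
  | reg _ => 1
  | load _ e => e.cost + 1
  | succ e => e.cost + 1
  | add e f => e.cost + (f.cost + (4 * X + 2))
  | iflt a b e f => a.cost + (b.cost + (1 + e.cost + f.cost))
  | sum _ e => X * ((e.cost + (4 * X + 2)) + 2) + 5

/-- Registers from `d` on serve as a stack: a second operand is computed from `d + 1` on, so the
first one in `d` survives. -/
theorem runs_compile (e : Exp) (d : ℕ) (hd : 0 < d) (he : e.wf d) (σ : State) :
    Runs (e.compile d) σ (e.cost.eval (σ.reg 0)) (fun τ =>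
      τ.reg d = e.eval σ ∧ Agree d σ τ) := by
  induction e generalizing d σ with
  | const c =>
    exact ⟨1, _, .const d c σ, by simp [cost], by simp [eval, State.setReg_reg],
      (Agree.refl d σ).setReg_right le_rfl _⟩
  | reg x =>
    exact ⟨1, _, .copy d x σ, by simp [cost], by simp [eval, State.setReg_reg],
      (Agree.refl d σ).setReg_right le_rfl _⟩
  | load a e ih =>
    simp only [cost, Polynomial.eval_add, Polynomial.eval_one]
    refine (ih d hd he σ).seq fun τ hτ => ⟨1, _, .load d a d τ, le_rfl, ?_,
      hτ.2.setReg_right le_rfl _⟩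
    simp [eval, State.setReg_reg, hτ.1, hτ.2.1]
  | succ e ih =>
    simp only [cost, Polynomial.eval_add, Polynomial.eval_one]
    refine (ih d hd he σ).seq fun τ hτ => ⟨1, _, .inc d τ, le_rfl, ?_,
      hτ.2.setReg_right le_rfl _⟩
    simp [eval, State.setReg_reg, hτ.1]
  | add e f ihe ihf =>
    simp only [wf, Bool.and_eq_true] at he
    simp only [cost, Polynomial.eval_add]
    refine (ihe d hd he.1 σ).seq fun τ hτ => ?_
    have h0 : τ.reg 0 = σ.reg 0 := (hτ.2.2 0 hd).symm
    refine Runs.seq (R := fun υ => υ.reg (d + 1) = f.eval σ ∧ Agree (d + 1) τ υ) ?_ fun υ hυ => ?_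
    · have := ihf (d + 1) (by omega) (wf_mono (by omega) f he.2) τ
      rw [h0] at this
      exact this.weaken le_rfl fun υ h => ⟨by rw [h.1, eval_congr hd f he.2 hτ.2], h.2⟩
    · have h0' : υ.reg 0 = σ.reg 0 := by rw [← h0, hυ.2.2 0 (by omega)]
      have hd' : υ.reg d = e.eval σ := by rw [← hυ.2.2 d (by omega), hτ.1]
      refine (runs_addLoop (x := d) (r := d + 1) (i := d + 2) hd (by omega) (by omega) υ).weaken
        (by simp [h0']) fun υ' h => ⟨?_, ?_⟩
      · rw [← h.2 d (by omega)]
        simp [State.setReg_reg, eval, h0', hd', hυ.1]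
      · exact (hτ.2.trans (hυ.2.mono (by omega))).trans
          ((((Agree.refl d υ).setReg_right le_rfl _)).trans (h.mono (by omega)))
  | iflt a b e f iha ihb ihe ihf =>
    simp only [wf, Bool.and_eq_true] at he
    obtain ⟨⟨⟨ha, hb⟩, he⟩, hf⟩ := he
    simp only [cost, Polynomial.eval_add]
    refine (iha d hd ha σ).seq fun τ hτ => ?_
    have h0 : τ.reg 0 = σ.reg 0 := (hτ.2.2 0 hd).symm
    refine Runs.seq (R := fun υ => υ.reg (d + 1) = b.eval σ ∧ Agree (d + 1) τ υ) ?_ fun υ hυ => ?_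
    · have := ihb (d + 1) (by omega) (wf_mono (by omega) b hb) τ
      rw [h0] at this
      exact this.weaken le_rfl fun υ h => ⟨by rw [h.1, eval_congr hd b hb hτ.2], h.2⟩
    · have h0' : υ.reg 0 = σ.reg 0 := by rw [← h0, hυ.2.2 0 (by omega)]
      have hd' : υ.reg d = a.eval σ := by rw [← hυ.2.2 d (by omega), hτ.1]
      have hA : Agree d σ υ := hτ.2.trans (hυ.2.mono (by omega))
      by_cases hlt : a.eval σ < b.eval σ
      · obtain ⟨t, υ', h1, h2, h3, h4⟩ := ihe d hd he υ
        refine ⟨_, υ', .ite_true (by simpa [Test.Holds, hd', hυ.1]) h1, ?_, ?_, hA.trans h4⟩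
        · rw [h0'] at h2; simp only [Polynomial.eval_one]; omega
        · rw [h3, eval, if_pos hlt, eval_congr hd e he hA]
      · obtain ⟨t, υ', h1, h2, h3, h4⟩ := ihf d hd hf υ
        refine ⟨_, υ', .ite_false (by simpa [Test.Holds, hd', hυ.1] using hlt) h1, ?_, ?_,
          hA.trans h4⟩
        · rw [h0'] at h2; simp only [Polynomial.eval_one]; omega
        · rw [h3, eval, if_neg hlt, eval_congr hd f hf hA]
  | sum x e ih =>
    simp only [wf, Bool.and_eq_true, decide_eq_true_eq] at he
    obtain ⟨⟨hx0, hxd⟩, he⟩ := he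
    set n := σ.reg 0 with hn
    -- Register `d` accumulates the sum, and `d + 1` keeps the old content of the bound variable
    -- `x`, which is restored at the end.
    let I : ℕ → State → Prop := fun k τ => Agree d (σ.setReg x k) τ ∧ τ.reg (d + 1) = σ.reg x ∧
      τ.reg d = ∑ j ∈ Finset.range k, min (e.eval (σ.setReg x j)) n
    have hloop : ∀ τ, I 0 (τ.setReg x 0) →
        Runs (forLoop x (.seq (e.compile (d + 2)) (addLoop d (d + 2) (d + 3)))) τ
          (n * ((e.cost.eval n + (4 * n + 2)) + 2) + 2) (I n) := by
      intro τ hτ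
      refine Runs.forLoop I ?_ ?_ hτ ?_
      · intro k τ h
        rw [← h.1.2 x hxd]; simp [State.setReg_reg]
      · intro k τ h
        rw [← h.1.2 0 hd, State.setReg_reg, if_neg (by omega)]
      · intro k hk τ ⟨hA, hs, hv⟩
        have h0 : τ.reg 0 = n := by rw [← hA.2 0 hd, State.setReg_reg, if_neg (by omega)]
        refine Runs.seq (R := fun υ => υ.reg (d + 2) = e.eval (σ.setReg x k) ∧ Agree (d + 2) τ υ)
          ?_ fun υ hυ => ?_
        · have := ih (d + 2) (by omega) (wf_mono (by omega) e he) τ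
          rw [h0] at this
          exact this.weaken le_rfl fun υ h => ⟨by rw [h.1, eval_congr hd e he hA], h.2⟩
        · have h0' : υ.reg 0 = n := by rw [← h0, hυ.2.2 0 (by omega)]
          refine (runs_addLoop (x := d) (r := d + 2) (i := d + 3) hd (by omega) (by omega)
            υ).weaken (by rw [h0']) fun υ' h => ⟨⟨?_, ?_⟩, ?_, ?_⟩
          · rw [State.setReg_arr, State.setReg_arr, ← h.1]
            exact hA.1.trans hυ.2.1
          · intro y hy
            have e1 := h.2 y (by omega)
            have e2 := hυ.2.2 y (by omega)
            have e3 := hA.2 y hy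
            simp only [State.setReg_reg] at e1 e3 ⊢
            split_ifs at e1 e3 ⊢ <;> first | omega | (subst_vars; omega)
          · have e1 := h.2 (d + 1) (by omega)
            have e2 := hυ.2.2 (d + 1) (by omega)
            simp only [State.setReg_reg] at e1 ⊢
            split_ifs at e1 ⊢ <;> omega
          · have e1 := h.2 d (by omega)
            have e2 := hυ.2.2 d (by omega)
            rw [State.setReg_reg, if_pos rfl] at e1
            rw [State.setReg_reg, if_neg (by omega), ← e1, Finset.sum_range_succ, h0', hυ.1, ← e2,
              hv]
    have hfin : ∀ τ, I n τ → Runs (.copy x (d + 1)) τ 1 (fun τ =>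
        τ.reg d = (sum x e).eval σ ∧ Agree d σ τ) := by
      intro τ ⟨hA, hs, hv⟩
      refine ⟨1, _, .copy x (d + 1) τ, le_rfl, ?_, hA.1, fun y hy => ?_⟩
      · rw [State.setReg_reg, if_neg (by omega), hv]; rfl
      · have := hA.2 y hy
        simp only [State.setReg_reg] at this ⊢
        split_ifs at this ⊢ with h
        · rw [hs, h]
        · exact this
    have h3 : I 0 (((σ.setReg d 0).setReg (d + 1) ((σ.setReg d 0).reg x)).setReg x 0) := by
      refine ⟨⟨rfl, fun y hy => ?_⟩, ?_, ?_⟩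
      · simp only [State.setReg_reg]
        split_ifs <;> omega
      · simp only [State.setReg_reg]
        split_ifs <;> omega
      · simp only [State.setReg_reg]
        split_ifs <;> first | omega | rfl
    refine Runs.weaken (Runs.seq (S := 1)
      (T := 1 + ((n * ((e.cost.eval n + (4 * n + 2)) + 2) + 2) + 1))
      (R := fun τ => τ = σ.setReg d 0)
      ⟨1, _, .const d 0 σ, le_rfl, rfl⟩ fun τ hτ => ?_) ?_ fun _ h => h
    · subst hτ
      refine Runs.seq (S := 1) (R := fun τ => τ = (σ.setReg d 0).setReg (d + 1)
        ((σ.setReg d 0).reg x)) ⟨1, _, .copy (d + 1) x _, le_rfl, rfl⟩ fun τ hτ => ?_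
      subst hτ
      exact (hloop _ h3).seq hfin
    · simp only [cost, Polynomial.eval_add, Polynomial.eval_mul, Polynomial.eval_X,
        Polynomial.eval_ofNat]
      omega

end Exp

/-! ### Loop programs and their translation -/

/-- Programs; the body of `forN x p` is executed for the values `0, …, n - 1` of register `x`. -/
inductive Prog where
  | assign (x : ℕ) (e : Exp)
  | store (a : ℕ) (e f : Exp)
  | seq (p q : Prog)
  | forN (x : ℕ) (p : Prog)

namespace Prog

/-- The state reached by a program. -/
def eval : Prog → State → State
  | assign x e, σ => σ.setReg x (e.eval σ)
  | store a e f, σ => σ.setArr a (e.eval σ) (f.eval σ)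
  | seq p q, σ => q.eval (p.eval σ)
  | forN x p, σ => Nat.rec (σ.setReg x 0) (fun k τ => (p.eval τ).setReg x (k + 1)) (σ.reg 0)

/-- The registers a program writes to. -/
def regs : Prog → List ℕ
  | assign x _ => [x]
  | store _ _ _ => []
  | seq p q => p.regs ++ q.regs
  | forN x p => x :: p.regs

/-- The arrays a program writes to. -/
def arrs : Prog → List ℕ
  | assign _ _ => []
  | store a _ _ => [a]
  | seq p q => p.arrs ++ q.arrs
  | forN _ p => p.arrs

/-- All registers mentioned are below `d`, register `0` is never changed, and the body of a loop
does not change the loop variable. -/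
def wf (d : ℕ) : Prog → Bool
  | assign x e => decide (0 < x) && decide (x < d) && e.wf d
  | store _ e f => e.wf d && f.wf d
  | seq p q => p.wf d && q.wf d
  | forN x p => decide (0 < x) && decide (x < d) && decide (x ∉ p.regs) && p.wf d

theorem eval_reg (p : Prog) (σ : State) {y : ℕ} (hy : y ∉ p.regs) :
    (p.eval σ).reg y = σ.reg y := by
  induction p generalizing σ with
  | assign x e => simp only [regs, List.mem_singleton] at hy; simp [eval, State.setReg_reg, hy]
  | store a e f => rfl
  | seq p q ihp ihq =>
    simp only [regs, List.mem_append, not_or] at hy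
    rw [eval, ihq _ hy.2, ihp _ hy.1]
  | forN x p ih =>
    simp only [regs, List.mem_cons, not_or] at hy
    rw [eval]
    induction σ.reg 0 with
    | zero => simp [State.setReg_reg, hy.1]
    | succ k ihk => simp only [State.setReg_reg, hy.1, if_false]; rw [ih _ hy.2, ihk]

theorem eval_arr (p : Prog) (σ : State) {a : ℕ} (ha : a ∉ p.arrs) :
    (p.eval σ).arr a = σ.arr a := by
  induction p generalizing σ with
  | assign x e => rfl
  | store b e f =>
    simp only [arrs, List.mem_singleton] at ha
    funext i
    simp [eval, State.setArr_arr, ha]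
  | seq p q ihp ihq =>
    simp only [arrs, List.mem_append, not_or] at ha
    rw [eval, ihq _ ha.2, ihp _ ha.1]
  | forN x p ih =>
    rw [eval]
    induction σ.reg 0 with
    | zero => rfl
    | succ k ihk => rw [State.setReg_arr, ih _ ha, ihk]

theorem zero_notMem_regs {d : ℕ} (p : Prog) (hp : p.wf d) : 0 ∉ p.regs := by
  induction p with
  | assign x e => simp [wf, regs] at hp ⊢; omega
  | store a e f => simp [regs]
  | seq p q ihp ihq => simp [wf, regs] at hp ⊢; exact ⟨ihp hp.1, ihq hp.2⟩
  | forN x p ih => simp [wf, regs] at hp ⊢; exact ⟨by omega, ih hp.2⟩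

/-- The invariant rule for loops. -/
theorem forN_inv {x : ℕ} {p : Prog} (I : ℕ → State → Prop) {σ : State} (h0 : I 0 (σ.setReg x 0))
    (h : ∀ k < σ.reg 0, ∀ τ, τ.reg x = k → I k τ → I (k + 1) ((p.eval τ).setReg x (k + 1))) :
    I (σ.reg 0) ((forN x p).eval σ) ∧ ((forN x p).eval σ).reg x = σ.reg 0 := by
  rw [eval]
  have H : ∀ m ≤ σ.reg 0,
      I m (Nat.rec (σ.setReg x 0) (fun k τ => (p.eval τ).setReg x (k + 1)) m) ∧
      (Nat.rec (σ.setReg x 0) (fun k τ => (p.eval τ).setReg x (k + 1)) m : State).reg x = m := by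
    intro m hm
    induction m with
    | zero => exact ⟨h0, by simp [State.setReg_reg]⟩
    | succ k ih => exact ⟨h k hm _ (ih (by omega)).2 (ih (by omega)).1, by simp [State.setReg_reg]⟩
  exact H _ le_rfl

/-- Translation of a program, with scratch registers from `d` on. -/
def compile (d : ℕ) : Prog → Cmd
  | assign x e => .seq (e.compile d) (.copy x d)
  | store a e f => .seq (e.compile d) (.seq (f.compile (d + 1)) (.store a d (d + 1)))
  | seq p q => .seq (p.compile d) (q.compile d)
  | forN x p => forLoop x (p.compile d)

open Polynomial in
/-- A bound for the running time of the translation, as a polynomial in `n`. -/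
noncomputable def cost : Prog → Polynomial ℕ
  | assign _ e => e.cost + 1
  | store _ e f => e.cost + (f.cost + 1)
  | seq p q => p.cost + q.cost
  | forN _ p => X * (p.cost + 2) + 2

/-- The machine state `τ` follows the ideal state `σ` only up to the scratch registers, which
well-formed programs never read. -/
theorem runs_compile {d : ℕ} (hd : 0 < d) (p : Prog) (hp : p.wf d) {σ τ : State}
    (h : Agree d σ τ) :
    Runs (p.compile d) τ (p.cost.eval (σ.reg 0)) (Agree d (p.eval σ)) := by
  induction p generalizing σ τ with
  | assign x e =>
    simp only [wf, Bool.and_eq_true, decide_eq_true_eq] at hp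
    simp only [cost, Polynomial.eval_add, Polynomial.eval_one]
    have := e.runs_compile d hd hp.2 τ
    rw [← h.2 0 hd] at this
    refine this.seq fun υ hυ => ⟨1, _, .copy x d υ, le_rfl, ?_⟩
    rw [hυ.1, ← e.eval_congr hd hp.2 h]
    exact (h.trans hυ.2).setReg x _
  | store a e f =>
    simp only [wf, Bool.and_eq_true] at hp
    simp only [cost, Polynomial.eval_add, Polynomial.eval_one]
    have := e.runs_compile d hd hp.1 τ
    rw [← h.2 0 hd] at this
    refine this.seq fun υ hυ => ?_
    have hA := h.trans hυ.2
    have := f.runs_compile (d + 1) (by omega) (f.wf_mono (by omega) hp.2) υ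
    rw [← hA.2 0 hd] at this
    refine this.seq fun υ' hυ' => ⟨1, _, .store a d (d + 1) υ', le_rfl, ?_⟩
    rw [hυ'.1, ← f.eval_congr hd hp.2 hA, ← hυ'.2.2 d (by omega), hυ.1, ← e.eval_congr hd hp.1 h]
    exact (hA.trans (hυ'.2.mono (by omega))).setArr a _ _
  | seq p q ihp ihq =>
    simp only [wf, Bool.and_eq_true] at hp
    simp only [cost, Polynomial.eval_add]
    refine (ihp hp.1 h).seq fun υ hυ => ?_
    have := ihq hp.2 hυ
    rwa [eval_reg p σ (zero_notMem_regs p hp.1)] at this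
  | forN x p ih =>
    simp only [wf, Bool.and_eq_true, decide_eq_true_eq] at hp
    obtain ⟨⟨⟨hx0, hxd⟩, hxp⟩, hp⟩ := hp
    simp only [cost, Polynomial.eval_add, Polynomial.eval_mul, Polynomial.eval_X,
      Polynomial.eval_ofNat]
    let F : ℕ → State := fun m =>
      Nat.rec (σ.setReg x 0) (fun k τ => (p.eval τ).setReg x (k + 1)) m
    have hFx : ∀ k, (F k).reg x = k := by
      intro k; cases k <;> simp [F, State.setReg_reg]
    have hF0 : ∀ k, (F k).reg 0 = σ.reg 0 := by
      intro k
      induction k with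
      | zero => simp [F, State.setReg_reg, hx0.ne]
      | succ k ihk =>
        have : (F (k + 1)).reg 0 = (p.eval (F k)).reg 0 := by
          simp [F, State.setReg_reg, hx0.ne]
        rw [this, eval_reg p _ (zero_notMem_regs p hp), ihk]
    refine (Runs.forLoop (fun k τ => Agree d (F k) τ) (n := σ.reg 0) ?_ ?_ (h.setReg x 0) ?_)
    · intro k τ hk; rw [← hk.2 x hxd, hFx]
    · intro k τ hk; rw [← hk.2 0 hd, hF0]
    · intro k hk υ hυ
      have := ih hp hυ
      rw [hF0] at this
      refine this.weaken le_rfl fun υ' h' => ?_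
      have hk' : υ'.reg x = k := by rw [← h'.2 x hxd, eval_reg p _ hxp, hFx]
      rw [hk']
      exact h'.setReg x (k + 1)

end Prog

end RAM

/-! ### Bicliques in a graph with an elimination order

The vertices are `0, …, n - 1`, and `A` is the adjacency relation. A labelling `B` describes a
family of bicliques: the vertices labelled `1` and `2` are on fixed sides, those labelled `3` may be
put on either side, and those labelled `0` are left out. -/

namespace Biclique

variable {A : ℕ → ℕ → Prop} {n : ℕ}

/-- All bicliques obtained from the labelling are bicliques. -/
def IsLabelling (A : ℕ → ℕ → Prop) (n : ℕ) (B : ℕ → ℕ) : Prop :=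
  ∀ x < n, ∀ y < n, x ≠ y → B x ≠ 0 → B y ≠ 0 → (B x ≠ B y ∨ B x = 3) → A x y

open Classical in
/-- One step of the extension of a labelling: the vertex `j` gets label `3` if it is adjacent to
all labelled vertices. -/
noncomputable def extendStep (A : ℕ → ℕ → Prop) (n thr j : ℕ) (B : ℕ → ℕ) : ℕ → ℕ :=
  Function.update B j (if thr ≤ j ∧ ∀ y < n, B y ≠ 0 → A j y then 3 else B j)

/-- Extension of a labelling by vertices below `m`, but not below `thr`. -/
noncomputable def extend (A : ℕ → ℕ → Prop) (n thr : ℕ) (B : ℕ → ℕ) : ℕ → ℕ → ℕ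
  | 0 => B
  | j + 1 => extendStep A n thr j (extend A n thr B j)

theorem IsLabelling.extendStep {B : ℕ → ℕ} (hs : ∀ x y, A x y → A y x)
    (hB : IsLabelling A n B) (thr j : ℕ) : IsLabelling A n (extendStep A n thr j B) := by
  intro x hx y hy hxy h1 h2 h3
  by_cases hc : thr ≤ j ∧ ∀ y < n, B y ≠ 0 → A j y
  · simp only [Biclique.extendStep, if_pos hc, Function.update_apply] at h1 h2 h3
    by_cases hxj : x = j
    · rw [if_neg (by omega)] at h2
      exact hxj ▸ hc.2 y hy h2
    · rw [if_neg hxj] at h1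
      by_cases hyj : y = j
      · exact hyj ▸ hs _ _ (hc.2 x hx h1)
      · rw [if_neg hyj] at h2
        rw [if_neg hxj, if_neg hyj] at h3
        exact hB x hx y hy hxy h1 h2 h3
  · simp only [Biclique.extendStep, if_neg hc, Function.update_eq_self] at h1 h2 h3
    exact hB x hx y hy hxy h1 h2 h3

theorem IsLabelling.extend {B : ℕ → ℕ} (hs : ∀ x y, A x y → A y x)
    (hB : IsLabelling A n B) (thr m : ℕ) : IsLabelling A n (extend A n thr B m) := by
  induction m with
  | zero => exact hB
  | succ m ih => exact ih.extendStep hs thr m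

theorem extend_of_le {thr m : ℕ} {B : ℕ → ℕ} (h : m ≤ thr) : extend A n thr B m = B := by
  induction m with
  | zero => rfl
  | succ m ih =>
    rw [extend, ih (by omega), extendStep, if_neg (by omega), Function.update_eq_self]

/-- When the pass reaches `m`, only vertices before `m` are labelled, so adjacency to all labelled
vertices concerns earlier vertices alone. -/
theorem extend_eq_zero {thr m : ℕ} {B : ℕ → ℕ} (hB : ∀ x, thr ≤ x → B x = 0) (hm : thr ≤ m)
    {x : ℕ} (hx : m ≤ x) : extend A n thr B m x = 0 := by
  induction m with
  | zero => exact hB x (hm.trans hx)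
  | succ m ih =>
    rw [extend, extendStep, Function.update_of_ne (by omega)]
    rcases Nat.lt_or_ge m thr with h | h
    · rw [extend_of_le h.le]; exact hB x (by omega)
    · exact ih h (by omega)

open Classical in
/-- The labelling with label `1` on `T` and label `2` on the common neighbours of `T` up to `v`. -/
noncomputable def seedLabel (A : ℕ → ℕ → Prop) (n v : ℕ) (T : ℕ → Prop) (x : ℕ) : ℕ :=
  if T x then 1 else if x ≤ v ∧ ∀ y < n, T y → A x y then 2 else 0

theorem isLabelling_seedLabel (hs : ∀ x y, A x y → A y x) (v : ℕ) (T : ℕ → Prop) :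
    IsLabelling A n (seedLabel A n v T) := by
  intro x hx y hy hxy h1 h2 h3
  simp only [seedLabel] at h1 h2 h3
  split_ifs at h1 h2 h3 with a b c d e f
  all_goals first
    | omega
    | exact hs _ _ (by tauto)

/-! ### Starting labellings, and covering every biclique -/

/-- The candidates for one side of a biclique whose last vertex is `v`, when that side lies in the
neighbourhood of `u`, a non-neighbour of `v`. -/
def InCandidates (A : ℕ → ℕ → Prop) (v u x : ℕ) : Prop :=
  x = v ∨ (x ≤ v ∧ A v x ∧ A u x)

/-- A pair of non-adjacent vertices, the larger one first. -/
def IsSeed (A : ℕ → ℕ → Prop) (n v u : ℕ) : Prop := v < n ∧ u < v ∧ ¬ A v u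

/-- The set `S` can be labelled `2` or `3`, the set `T` can be labelled `1` or `3`. -/
def Covers (B : ℕ → ℕ) (S T : Finset ℕ) : Prop :=
  (∀ x ∈ S, B x = 2 ∨ B x = 3) ∧ ∀ x ∈ T, B x = 1 ∨ B x = 3

/-- Labellings from which the search starts, and the vertex where their extension begins. -/
def IsStart (A : ℕ → ℕ → Prop) (n : ℕ) (B : ℕ → ℕ) (thr : ℕ) : Prop :=
  ((B = fun _ => 0) ∧ thr = 0) ∨ ∃ v u, IsSeed A n v u ∧ thr = v + 1 ∧
    ∃ T : ℕ → Prop, (∀ x, T x → InCandidates A v u x) ∧ B = seedLabel A n v T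

theorem InCandidates.le {v u x : ℕ} (h : InCandidates A v u x) : x ≤ v := by
  rcases h with h | h
  · exact h.le
  · exact h.1

theorem IsStart.eq_zero {B : ℕ → ℕ} {thr : ℕ} (h : IsStart A n B thr) {x : ℕ} (hx : thr ≤ x) :
    B x = 0 := by
  rcases h with ⟨rfl, _⟩ | ⟨v, u, _, rfl, T, hT, rfl⟩
  · rfl
  · rw [seedLabel, if_neg fun h => by have := (hT x h).le; omega, if_neg (by omega)]

theorem IsStart.isLabelling (hs : ∀ x y, A x y → A y x) {B : ℕ → ℕ} {thr : ℕ}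
    (h : IsStart A n B thr) : IsLabelling A n B := by
  rcases h with ⟨rfl, _⟩ | ⟨v, u, _, rfl, T, hT, rfl⟩
  · intro x _ y _ _ h; exact absurd rfl h
  · exact isLabelling_seedLabel hs v T

/-- A step changes labels only to `3`, which is admissible on both sides. -/
theorem Covers.extendStep {B : ℕ → ℕ} {S T : Finset ℕ} (h : Covers B S T) (thr j : ℕ) :
    Covers (extendStep A n thr j B) S T := by
  constructor
  · intro x hx
    rw [Biclique.extendStep, Function.update_apply]
    have := h.1 x hx
    split_ifs with h1 h2
    · exact .inr rfl
    · exact h1 ▸ this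
    · exact this
  · intro x hx
    rw [Biclique.extendStep, Function.update_apply]
    have := h.2 x hx
    split_ifs with h1 h2
    · exact .inr rfl
    · exact h1 ▸ this
    · exact this

/-- This is the inductive step. The sides may come out exchanged because the guessed candidate set
always gets label `1`, whichever side it is. -/
theorem exists_covers_of_mem (hs : ∀ x y, A x y → A y x) (hi : ∀ x, ¬ A x x) {m : ℕ} (hm : m < n)
    (IH : ∀ S T : Finset ℕ, S ⊆ Finset.range m → T ⊆ Finset.range m →
      (∀ s ∈ S, ∀ t ∈ T, A s t) → ∃ B thr, IsStart A n B thr ∧ thr ≤ m ∧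
        (Covers (extend A n thr B m) S T ∨ Covers (extend A n thr B m) T S))
    {S T : Finset ℕ} (hS : S ⊆ Finset.range (m + 1)) (hT : T ⊆ Finset.range (m + 1))
    (hST : ∀ s ∈ S, ∀ t ∈ T, A s t) (hmS : m ∈ S) :
    ∃ B thr, IsStart A n B thr ∧ thr ≤ m + 1 ∧
        (Covers (extend A n thr B (m + 1)) S T ∨ Covers (extend A n thr B (m + 1)) T S) := by
  have hSm : ∀ x ∈ S, x ≤ m := fun x hx => by have := Finset.mem_range.1 (hS hx); omega
  have hTm : ∀ x ∈ T, x ≤ m := fun x hx => by have := Finset.mem_range.1 (hT hx); omega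
  have hdisj : ∀ x ∈ S, x ∉ T := fun x h h' => hi x (hST x h x h')
  by_cases ha : ∃ u < m, ¬ A m u ∧ ∀ t ∈ T, A u t
  · obtain ⟨u, hu, hmu, huT⟩ := ha
    refine ⟨_, m + 1, .inr ⟨m, u, ⟨hm, hu, hmu⟩, rfl, (· ∈ T), fun x hx => .inr
      ⟨hTm x hx, hST m hmS x hx, huT x hx⟩, rfl⟩, le_rfl, .inl ?_⟩
    rw [extend_of_le le_rfl]
    refine ⟨fun x hx => .inl ?_, fun x hx => .inl (if_pos hx)⟩
    rw [seedLabel, if_neg (hdisj x hx), if_pos ⟨hSm x hx, fun y _ hy => hST x hx y hy⟩]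
  by_cases hb : ∃ u < m, ¬ A m u ∧ ∀ s ∈ S, s ≠ m → A u s
  · obtain ⟨u, hu, hmu, huS⟩ := hb
    -- A vertex of `S` not adjacent to `m` would itself be the non-neighbour excluded by `ha`.
    have hmS' : ∀ s ∈ S, s ≠ m → A m s := by
      intro s hsS hsm
      by_contra hc
      exact ha ⟨s, by have := hSm s hsS; omega, hc, fun t ht => hST s hsS t ht⟩
    refine ⟨_, m + 1, .inr ⟨m, u, ⟨hm, hu, hmu⟩, rfl, (· ∈ S), fun x hx => ?_, rfl⟩, le_rfl,
      .inr ?_⟩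
    · by_cases hxm : x = m
      · exact .inl hxm
      · exact .inr ⟨hSm x hx, hmS' x hx hxm, huS x hx hxm⟩
    rw [extend_of_le le_rfl]
    refine ⟨fun x hx => .inl ?_, fun x hx => .inl (if_pos hx)⟩
    rw [seedLabel, if_neg fun h => hdisj x h hx,
      if_pos ⟨hTm x hx, fun y _ hy => hs _ _ (hST y hy x hx)⟩]
  · push Not at ha hb
    have hmT : m ∉ T := hdisj m hmS
    obtain ⟨B, thr, hB, hthr, hcov⟩ := IH (S.erase m) T
      (fun x hx => by
        have := hSm x (Finset.mem_of_mem_erase hx)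
        have := Finset.ne_of_mem_erase hx
        simp; omega)
      (fun x hx => by
        have := hTm x hx
        have : x ≠ m := fun h => hmT (h ▸ hx)
        simp; omega)
      (fun s hs' t ht => hST s (Finset.mem_of_mem_erase hs') t ht)
    refine ⟨B, thr, hB, by omega, ?_⟩
    set L := extend A n thr B m with hL
    have hlab : IsLabelling A n L := (hB.isLabelling hs).extend hs thr m
    -- Non-adjacent labelled vertices carry the same label, different from `3`. A labelled
    -- non-neighbour `y` of `m` misses some `t` in `T` and some `s` in `S`, so it would share a
    -- label with both (or be one of them), although `s` and `t` are labelled for opposite sides.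
    have huniv : ∀ y < n, L y ≠ 0 → A m y := by
      intro y hy hLy
      have hym : y < m := by
        by_contra h
        exact hLy (extend_eq_zero (fun x hx => hB.eq_zero hx) hthr (by omega))
      by_contra hmy
      obtain ⟨t, ht, hyt⟩ := ha y hym hmy
      obtain ⟨s, hsS, hsm, hys⟩ := hb y hym hmy
      have htm : t < n := by have := hTm t ht; omega
      have hsm' : s < n := by have := hSm s hsS; omega
      have hst : s ≠ t := fun h => hdisj s hsS (h ▸ ht)
      have key : ∀ z < n, L z ≠ 0 → ¬ A y z → y ≠ z → L y = L z ∧ L y ≠ 3 := by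
        intro z hz hz0 hA hne
        by_contra hc
        exact hA (hlab y hy z hz hne hLy hz0 (by tauto))
      have key' : ∀ z < n, ¬ A y z → y ≠ z → L z ≠ 3 := by
        intro z hz hA hne h3
        exact hA (hs _ _ (hlab z hz y hy hne.symm (by omega) hLy (.inr h3)))
      have hsE : s ∈ S.erase m := Finset.mem_erase.2 ⟨hsm, hsS⟩
      rcases hcov with hcov | hcov
      all_goals
        have c1 := hcov.1
        have c2 := hcov.2
        by_cases hyt' : y = t
        · subst hyt'
          have := key s hsm' (by first | (have := c1 s hsE; omega) | (have := c2 s hsE; omega)) hys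
            hst.symm
          have := key' s hsm' hys hst.symm
          first
          | (have := c1 s hsE; have := c2 y ht; omega)
          | (have := c2 s hsE; have := c1 y ht; omega)
        · by_cases hys' : y = s
          · subst hys'
            have := key t htm (by first | (have := c1 t ht; omega) | (have := c2 t ht; omega))
              hyt hyt'
            have := key' t htm hyt hyt'
            first
            | (have := c1 y hsE; have := c2 t ht; omega)
            | (have := c2 y hsE; have := c1 t ht; omega)
          · have := key t htm (by first | (have := c1 t ht; omega) | (have := c2 t ht; omega))
              hyt hyt'
            have := key' t htm hyt hyt'
            have := key s hsm' (by first | (have := c1 s hsE; omega) | (have := c2 s hsE; omega))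
              hys hys'
            have := key' s hsm' hys hys'
            first
            | (have := c1 s hsE; have := c2 t ht; omega)
            | (have := c2 s hsE; have := c1 t ht; omega)
    have hm3 : extend A n thr B (m + 1) m = 3 := by
      rw [extend, extendStep, Function.update_self, if_pos ⟨hthr, huniv⟩]
    rcases hcov with hcov | hcov
    · refine .inl ⟨fun x hx => ?_, (hcov.extendStep thr m).2⟩
      by_cases hxm : x = m
      · exact .inr (hxm ▸ hm3)
      · exact (hcov.extendStep thr m).1 x (Finset.mem_erase.2 ⟨hxm, hx⟩)
    · refine .inr ⟨(hcov.extendStep thr m).1, fun x hx => ?_⟩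
      by_cases hxm : x = m
      · exact .inr (hxm ▸ hm3)
      · exact (hcov.extendStep thr m).2 x (Finset.mem_erase.2 ⟨hxm, hx⟩)

theorem exists_covers (hs : ∀ x y, A x y → A y x) (hi : ∀ x, ¬ A x x) {m : ℕ} (hm : m ≤ n)
    (S T : Finset ℕ) (hS : S ⊆ Finset.range m) (hT : T ⊆ Finset.range m)
    (hST : ∀ s ∈ S, ∀ t ∈ T, A s t) :
    ∃ B thr, IsStart A n B thr ∧ thr ≤ m ∧
        (Covers (extend A n thr B m) S T ∨ Covers (extend A n thr B m) T S) := by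
  induction m generalizing S T with
  | zero =>
    refine ⟨_, 0, .inl ⟨rfl, rfl⟩, le_rfl, .inl ?_⟩
    simp only [Finset.range_zero, Finset.subset_empty] at hS hT
    subst hS hT
    simp [Covers]
  | succ m ih =>
    by_cases hmS : m ∈ S
    · exact exists_covers_of_mem hs hi hm (ih (by omega)) hS hT hST hmS
    by_cases hmT : m ∈ T
    · obtain ⟨B, thr, h1, h2, h3⟩ := exists_covers_of_mem hs hi hm (ih (by omega)) hT hS
        (fun s hs' t ht => hs _ _ (hST t ht s hs')) hmT
      exact ⟨B, thr, h1, h2, h3.symm⟩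
    · have sub : ∀ U : Finset ℕ, U ⊆ Finset.range (m + 1) → m ∉ U → U ⊆ Finset.range m := by
        intro U hU hmU x hx
        have := Finset.mem_range.1 (hU hx)
        have : x ≠ m := fun h => hmU (h ▸ hx)
        simp; omega
      obtain ⟨B, thr, h1, h2, h3⟩ := ih (by omega) S T (sub S hS hmS) (sub T hT hmT) hST
      exact ⟨B, thr, h1, by omega, h3.imp (·.extendStep thr m) (·.extendStep thr m)⟩

/-! #### Choosing sides -/

open Classical in
/-- The size of the second side if the vertices below `c` with label `3` are put there. -/
noncomputable def sideTwo (n : ℕ) (B : ℕ → ℕ) (c : ℕ) : ℕ :=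
  ((Finset.range n).filter fun x => B x = 2 ∨ (B x = 3 ∧ x < c)).card

open Classical in
/-- The size of the first side if the vertices from `c` on with label `3` are put there. -/
noncomputable def sideOne (n : ℕ) (B : ℕ → ℕ) (c : ℕ) : ℕ :=
  ((Finset.range n).filter fun x => B x = 1 ∨ (B x = 3 ∧ ¬ x < c)).card

/-- The count starts at zero and grows by at most one when `c` grows by one, so it takes every value
up to its maximum. -/
theorem exists_threshold (p : ℕ → Prop) [DecidablePred p] (n a : ℕ)
    (ha : a ≤ ((Finset.range n).filter p).card) :
    ∃ c ≤ n, ((Finset.range n).filter fun x => p x ∧ x < c).card = a := by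
  induction n with
  | zero => exact ⟨0, le_rfl, by simp at ha ⊢; exact ha.symm⟩
  | succ n ih =>
    by_cases h : a ≤ ((Finset.range n).filter p).card
    · obtain ⟨c, hc, h⟩ := ih h
      refine ⟨c, by omega, ?_⟩
      rw [Finset.range_add_one, Finset.filter_insert, if_neg (by omega), h]
    · refine ⟨n + 1, le_rfl, ?_⟩
      have : ((Finset.range (n + 1)).filter fun x => p x ∧ x < n + 1) =
          (Finset.range (n + 1)).filter p := by
        apply Finset.filter_congr
        simp +contextual
      rw [this]
      refine le_antisymm ?_ ha
      rw [Finset.range_add_one, Finset.filter_insert]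
      split_ifs
      · exact (Finset.card_insert_le _ _).trans (by omega)
      · omega

/-- The threshold puts exactly as many vertices labelled `3` on the second side as `S` contains.
They need not be those of `S`; by disjointness at least as many as `T` contains remain for the first
side. -/
theorem Covers.exists_threshold {B : ℕ → ℕ} {S T : Finset ℕ} (h : Covers B S T)
    (hS : S ⊆ Finset.range n) (hT : T ⊆ Finset.range n) (hST : Disjoint S T) :
    ∃ c ≤ n, S.card ≤ sideTwo n B c ∧ T.card ≤ sideOne n B c := by
  classical
  set S3 := S.filter fun x => B x = 3
  set T3 := T.filter fun x => B x = 3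
  set C := (Finset.range n).filter fun x => B x = 3
  have hS3 : S3 ⊆ C := Finset.filter_subset_filter _ hS
  have hT3 : T3 ⊆ C := Finset.filter_subset_filter _ hT
  obtain ⟨c, hc, hcard⟩ := Biclique.exists_threshold (fun x => B x = 3) n S3.card
    (Finset.card_le_card hS3)
  refine ⟨c, hc, ?_, ?_⟩
  · rw [sideTwo, Finset.filter_or, Finset.card_union_of_disjoint, hcard,
      ← Finset.card_filter_add_card_filter_not (s := S) fun x => B x = 3, add_comm]
    · refine Nat.add_le_add_right (Finset.card_le_card fun x hx => ?_) _
      obtain ⟨h1, h2⟩ := Finset.mem_filter.1 hx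
      exact Finset.mem_filter.2 ⟨hS h1, (h.1 x h1).resolve_right h2⟩
    · rw [Finset.disjoint_filter]
      intro x _ h1 h2; omega
  · have hsplit : C.card = S3.card +
        ((Finset.range n).filter fun x => B x = 3 ∧ ¬ x < c).card := by
      rw [← hcard, ← Finset.card_filter_add_card_filter_not (s := C) fun x => x < c,
        Finset.filter_filter, Finset.filter_filter]
    have hle : S3.card + T3.card ≤ C.card := by
      rw [← Finset.card_union_of_disjoint
        (hST.mono (Finset.filter_subset _ _) (Finset.filter_subset _ _))]
      exact Finset.card_le_card (Finset.union_subset hS3 hT3)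
    rw [sideOne, Finset.filter_or, Finset.card_union_of_disjoint,
      ← Finset.card_filter_add_card_filter_not (s := T) fun x => B x = 3, add_comm]
    · refine Nat.add_le_add (Finset.card_le_card fun x hx => ?_) ?_
      · obtain ⟨h1, h2⟩ := Finset.mem_filter.1 hx
        exact Finset.mem_filter.2 ⟨hT h1, (h.2 x h1).resolve_right h2⟩
      · change T3.card ≤ _
        omega
    · rw [Finset.disjoint_filter]
      intro x _ h1 h2; omega

/-! #### Masks -/

open Classical in
/-- The number of candidates before `x`. -/
noncomputable def rank (A : ℕ → ℕ → Prop) (n v u x : ℕ) : ℕ :=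
  ((Finset.range n).filter fun y => InCandidates A v u y ∧ y < x).card

/-- The candidates whose rank satisfies `M`. -/
def Chosen (A : ℕ → ℕ → Prop) (n : ℕ) (M : ℕ → Prop) (v u x : ℕ) : Prop :=
  InCandidates A v u x ∧ M (rank A n v u x)

open Classical in
/-- The labelling given by a pair of vertices and a mask. -/
noncomputable def startLabel (A : ℕ → ℕ → Prop) (n : ℕ) (M : ℕ → Prop) (v u x : ℕ) : ℕ :=
  if IsSeed A n v u then seedLabel A n v (Chosen A n M v u) x else 0

open Classical in
/-- The vertex from which the labelling `startLabel` is extended. -/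
noncomputable def startThr (A : ℕ → ℕ → Prop) (n v u : ℕ) : ℕ :=
  if IsSeed A n v u then v + 1 else 0

/-- The extension of `startLabel` by all vertices. -/
noncomputable def fullLabel (A : ℕ → ℕ → Prop) (n : ℕ) (M : ℕ → Prop) (v u : ℕ) : ℕ → ℕ :=
  extend A n (startThr A n v u) (startLabel A n M v u) n

theorem isStart_startLabel (M : ℕ → Prop) (v u : ℕ) :
    IsStart A n (startLabel A n M v u) (startThr A n v u) := by
  by_cases h : IsSeed A n v u
  · refine .inr ⟨v, u, h, if_pos h, _, fun x (hx : Chosen A n M v u x) => hx.1, ?_⟩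
    funext x
    rw [startLabel, if_pos h]
  · refine .inl ⟨?_, if_neg h⟩
    funext x
    rw [startLabel, if_neg h]

theorem not_isSeed (u : ℕ) : ¬ IsSeed A n n u := fun h => absurd h.1 (lt_irrefl _)

/-- The index `v = n` is never a seed, so it stands for the empty start, whatever the mask and `u`.
-/
theorem fullLabel_last (M M' : ℕ → Prop) (u u' : ℕ) :
    fullLabel A n M n u = fullLabel A n M' n u' := by
  unfold fullLabel startThr startLabel
  simp only [if_neg (not_isSeed _)]

/-- The `i`-th binary digit of `k` is one. -/
def maskBit (k i : ℕ) : Prop := k.testBit i = true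

open Classical in
-- On candidates `rank` is strictly increasing with values below `g`, so `g` bits indexed by rank
-- can prescribe any subset of them.
theorem exists_mask {v u g : ℕ} (hv : v < n)
    (hg : ((Finset.range n).filter (InCandidates A v u)).card ≤ g) (T : ℕ → Prop)
    (hT : ∀ x, T x → InCandidates A v u x) :
    ∃ k < 2 ^ g, Chosen A n (maskBit k) v u = T := by
  let b : Fin g → Bool := fun i => decide (∃ x, T x ∧ rank A n v u x = i)
  refine ⟨Nat.ofBits b, Nat.ofBits_lt_two_pow b, ?_⟩
  have hlt : ∀ x, InCandidates A v u x → rank A n v u x < g := by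
    intro x hx
    refine lt_of_lt_of_le (Finset.card_lt_card ?_) hg
    refine ⟨fun y hy => ?_, fun h => ?_⟩
    · rw [Finset.mem_filter] at hy ⊢
      exact ⟨hy.1, hy.2.1⟩
    · have := h (Finset.mem_filter.2 ⟨Finset.mem_range.2 (hx.le.trans_lt hv), hx⟩)
      exact lt_irrefl _ (Finset.mem_filter.1 this).2.2
  have hmono : ∀ x y, InCandidates A v u x → x < y → rank A n v u x < rank A n v u y := by
    intro x y hx hxy
    refine Finset.card_lt_card ⟨fun z hz => ?_, fun h => ?_⟩
    · rw [Finset.mem_filter] at hz ⊢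
      exact ⟨hz.1, hz.2.1, hz.2.2.trans hxy⟩
    · have := h (Finset.mem_filter.2 ⟨Finset.mem_range.2 (hx.le.trans_lt hv), hx, hxy⟩)
      exact lt_irrefl _ (Finset.mem_filter.1 this).2.2
  funext x
  refine propext ⟨fun ⟨hx, hM⟩ => ?_, fun hx => ⟨hT x hx, ?_⟩⟩
  · rw [maskBit, Nat.testBit_ofBits_lt b _ (hlt x hx)] at hM
    obtain ⟨y, hy, hyx⟩ := of_decide_eq_true hM
    rcases lt_trichotomy x y with h | h | h
    · have := hmono x y hx h
      simp only at hyx; omega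
    · exact h ▸ hy
    · have := hmono y x (hT y hy) h
      simp only at hyx; omega
  · rw [maskBit, Nat.testBit_ofBits_lt b _ (hlt x (hT x hx))]
    exact decide_eq_true ⟨x, hx, rfl⟩

/-- The mask `k` together with the pair `v`, `u` yields a biclique whose sizes satisfy `P`. -/
def Success (A : ℕ → ℕ → Prop) (n : ℕ) (P : ℕ → ℕ → Prop) (k v u : ℕ) : Prop :=
  ∃ c ≤ n, P (sideTwo n (fullLabel A n (maskBit k) v u) c)
    (sideOne n (fullLabel A n (maskBit k) v u) c)

open Classical in
-- Symmetry of `P` absorbs the possible exchange of sides, and monotonicity allows the sides found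
-- to be larger than those covered.
theorem exists_biclique_iff (hs : ∀ x y, A x y → A y x) (hi : ∀ x, ¬ A x x) {P : ℕ → ℕ → Prop}
    (hP : ∀ a b, P a b → P b a) (hP' : ∀ a b c d, a ≤ c → b ≤ d → P a b → P c d) {g : ℕ}
    (hg : ∀ v u, IsSeed A n v u → ((Finset.range n).filter (InCandidates A v u)).card ≤ g) :
    (∃ S T : Finset ℕ, S ⊆ Finset.range n ∧ T ⊆ Finset.range n ∧ (∀ s ∈ S, ∀ t ∈ T, A s t) ∧
      P S.card T.card) ↔
    ∃ k < 2 ^ g, (∃ v < n, ∃ u < n, Success A n P k v u) ∨ Success A n P k n 0 := by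
  constructor
  · rintro ⟨S, T, hS, hT, hST, hPST⟩
    have hdisj : Disjoint S T := Finset.disjoint_left.2 fun x h h' => hi x (hST x h x h')
    obtain ⟨B, thr, hB, -, hcov⟩ := exists_covers hs hi le_rfl S T hS hT hST
    have hc : ∃ c ≤ n, P (sideTwo n (extend A n thr B n) c) (sideOne n (extend A n thr B n) c) := by
      rcases hcov with hcov | hcov
      · obtain ⟨c, h1, h2, h3⟩ := hcov.exists_threshold hS hT hdisj
        exact ⟨c, h1, hP' _ _ _ _ h2 h3 hPST⟩
      · obtain ⟨c, h1, h2, h3⟩ := hcov.exists_threshold hT hS hdisj.symm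
        exact ⟨c, h1, hP' _ _ _ _ h2 h3 (hP _ _ hPST)⟩
    rcases hB with ⟨rfl, rfl⟩ | ⟨v, u, hvu, rfl, U, hU, rfl⟩
    · refine ⟨0, by positivity, .inr ?_⟩
      have : fullLabel A n (maskBit 0) n 0 = extend A n 0 (fun _ => 0) n := by
        unfold fullLabel startThr startLabel
        simp only [if_neg (not_isSeed _)]
      rwa [Success, this]
    · obtain ⟨k, hk, hkU⟩ := exists_mask hvu.1 (hg v u hvu) U hU
      refine ⟨k, hk, .inl ⟨v, hvu.1, u, hvu.2.1.trans hvu.1, ?_⟩⟩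
      have : fullLabel A n (maskBit k) v u = extend A n (v + 1) (seedLabel A n v U) n := by
        unfold fullLabel startThr startLabel
        simp only [if_pos hvu, hkU]
      rwa [Success, this]
  · rintro ⟨k, -, h⟩
    have H : ∃ v u, Success A n P k v u := by
      rcases h with ⟨v, _, u, _, h⟩ | h
      exacts [⟨v, u, h⟩, ⟨n, 0, h⟩]
    obtain ⟨v, u, c, -, hc⟩ := H
    have hlab : IsLabelling A n (fullLabel A n (maskBit k) v u) :=
      ((isStart_startLabel _ v u).isLabelling hs).extend hs _ n
    refine ⟨_, _, Finset.filter_subset _ _, Finset.filter_subset _ _, ?_, hc⟩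
    intro s hs' t ht
    obtain ⟨h1, h2⟩ := Finset.mem_filter.1 hs'
    obtain ⟨h3, h4⟩ := Finset.mem_filter.1 ht
    refine hlab s (Finset.mem_range.1 h1) t (Finset.mem_range.1 h3) ?_ ?_ ?_ ?_
    · rintro rfl; omega
    all_goals omega

end Biclique

namespace RAM

open Biclique

/-! ### Expressions for truth values -/

open Classical in
/-- The number of naturals below `n` satisfying `p`. -/
noncomputable def countBelow (n : ℕ) (p : ℕ → Prop) : ℕ := ((Finset.range n).filter p).card

theorem card_filter_range (n : ℕ) (p : ℕ → Prop) [DecidablePred p] :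
    ((Finset.range n).filter p).card = countBelow n p := by
  unfold countBelow; congr

theorem countBelow_congr {n : ℕ} {p q : ℕ → Prop} (h : ∀ k < n, p k ↔ q k) :
    countBelow n p = countBelow n q := by
  unfold countBelow
  congr 1
  ext x
  simp only [Finset.mem_filter, Finset.mem_range]
  exact and_congr_right (h x)

theorem countBelow_le (n : ℕ) (p : ℕ → Prop) : countBelow n p ≤ n := by
  classical
  rw [← card_filter_range]
  exact (Finset.card_filter_le _ _).trans (Finset.card_range n).le

theorem countBelow_le_of_lt {n g : ℕ} {p : ℕ → Prop} (h : ∀ m < n, p m → m < g) :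
    countBelow n p ≤ g := by
  rw [countBelow, ← Finset.card_range g]
  refine Finset.card_le_card fun m hm => ?_
  simp only [Finset.mem_filter, Finset.mem_range] at hm ⊢
  exact h m hm.1 hm.2

theorem le_countBelow {n c : ℕ} {p : ℕ → Prop} (hc : c ≤ n) (h : ∀ m < c, p m) :
    c ≤ countBelow n p := by
  rw [countBelow, ← Finset.card_range c]
  refine Finset.card_le_card fun m hm => ?_
  simp only [Finset.mem_filter, Finset.mem_range] at hm ⊢
  exact ⟨hm.trans_le hc, h m hm⟩

namespace Exp

/-- An expression is true if its value is not zero. -/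
def T (e : Exp) (σ : State) : Prop := e.eval σ ≠ 0

def lt (e f : Exp) : Exp := iflt e f (const 1) (const 0)

def cond (b e f : Exp) : Exp := iflt (const 0) b e f

def neg (e : Exp) : Exp := cond e (const 0) (const 1)

def and (e f : Exp) : Exp := cond e f (const 0)

def or (e f : Exp) : Exp := cond e (const 1) f

def eq (e f : Exp) : Exp := and (neg (lt e f)) (neg (lt f e))

def ex (x : ℕ) (e : Exp) : Exp := sum x e

def all (x : ℕ) (e : Exp) : Exp := neg (ex x (neg e))

def card (x : ℕ) (e : Exp) : Exp := sum x (cond e (const 1) (const 0))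

@[simp] theorem T_lt (e f : Exp) (σ : State) : (lt e f).T σ ↔ e.eval σ < f.eval σ := by
  simp [T, lt, eval]

open Classical in
@[simp] theorem eval_cond (b e f : Exp) (σ : State) :
    (cond b e f).eval σ = if b.T σ then e.eval σ else f.eval σ := by
  by_cases h : b.T σ
  · rw [if_pos h, cond, eval, eval, if_pos (Nat.pos_of_ne_zero h)]
  · rw [if_neg h, cond, eval, eval, if_neg fun h' => h (Nat.pos_iff_ne_zero.1 h')]

@[simp] theorem T_neg (e : Exp) (σ : State) : (neg e).T σ ↔ ¬ e.T σ := by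
  rw [T, neg, eval_cond]
  split_ifs <;> simp_all [eval]

@[simp] theorem T_and (e f : Exp) (σ : State) : (and e f).T σ ↔ e.T σ ∧ f.T σ := by
  rw [T, and, eval_cond]
  split_ifs with h <;> simp_all [eval, T]

@[simp] theorem T_or (e f : Exp) (σ : State) : (or e f).T σ ↔ e.T σ ∨ f.T σ := by
  rw [T, or, eval_cond]
  split_ifs with h <;> simp_all [eval, T]

@[simp] theorem T_eq (e f : Exp) (σ : State) : (eq e f).T σ ↔ e.eval σ = f.eval σ := by
  simp only [eq, T_and, T_neg, T_lt]; omega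

-- Capping at `n` does not hide a nonzero summand: if there is a summand at all, then `n` is
-- positive.
@[simp] theorem T_ex (x : ℕ) (e : Exp) (σ : State) :
    (ex x e).T σ ↔ ∃ k < σ.reg 0, e.T (σ.setReg x k) := by
  simp only [T, ex, eval, ne_eq, Finset.sum_eq_zero_iff, Finset.mem_range]
  push Not
  refine exists_congr fun k => and_congr_right fun hk => ?_
  omega

@[simp] theorem T_all (x : ℕ) (e : Exp) (σ : State) :
    (all x e).T σ ↔ ∀ k < σ.reg 0, e.T (σ.setReg x k) := by
  simp [all]

@[simp] theorem eval_card (x : ℕ) (e : Exp) (σ : State) :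
    (card x e).eval σ = countBelow (σ.reg 0) fun k => e.T (σ.setReg x k) := by
  rw [card, eval, countBelow, Finset.card_filter]
  refine Finset.sum_congr rfl fun k hk => ?_
  have := Finset.mem_range.1 hk
  rw [eval_cond]
  split_ifs <;> simp only [eval] <;> omega

@[simp] theorem eval_const (c : ℕ) (σ : State) : (const c).eval σ = c := rfl

@[simp] theorem eval_reg (x : ℕ) (σ : State) : (reg x).eval σ = σ.reg x := rfl

@[simp] theorem eval_load (a : ℕ) (e : Exp) (σ : State) :
    (load a e).eval σ = σ.arr a (e.eval σ) := rfl

@[simp] theorem T_load (a : ℕ) (e : Exp) (σ : State) :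
    (load a e).T σ ↔ σ.arr a (e.eval σ) ≠ 0 := Iff.rfl

@[simp] theorem T_reg (x : ℕ) (σ : State) : (reg x).T σ ↔ σ.reg x ≠ 0 := Iff.rfl

/-- The least value of register `z` that makes `e` true, with auxiliary variable `y`. -/
def least (y z : ℕ) (e : Exp) : Exp := card y (all z (or (lt (reg y) (reg z)) (neg e)))

/-- Adjacency of the vertices `e` and `f`, where `e` must not depend on register `60`. -/
def adj (e f : Exp) : Exp :=
  and (lt e (reg 0)) (and (lt f (reg 0))
    (load 0 (add (sum 60 (cond (lt (reg 60) e) (reg 0) (const 0))) f)))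

end Exp

/-- Adjacency after renumbering the vertices by `o`. -/
def renumber (A : ℕ → ℕ → Prop) (o : ℕ → ℕ) (x y : ℕ) : Prop := A (o x) (o y)

/-- The relation on `0, …, n - 1` with matrix `a`. -/
def matrixRel (n : ℕ) (a : ℕ → ℕ) (x y : ℕ) : Prop := x < n ∧ y < n ∧ a (x * n + y) ≠ 0

namespace Exp

/-- The product in the matrix index is a sum of `n` over all `k` below the row number. The guards
make both caps harmless. -/
theorem T_adj (e f : Exp) (σ : State) (he : ∀ k, e.eval (σ.setReg 60 k) = e.eval σ) :
    (adj e f).T σ ↔ matrixRel (σ.reg 0) (σ.arr 0) (e.eval σ) (f.eval σ) := by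
  simp only [adj, T_and, T_lt, eval_reg, T_load, matrixRel]
  refine and_congr_right fun h1 => and_congr_right fun h2 => ?_
  simp only [eval, eval_cond, T_lt, he, State.setReg_reg]
  have : ∑ k ∈ Finset.range (σ.reg 0), min (if k < e.eval σ then σ.reg 0 else 0) (σ.reg 0) =
      e.eval σ * σ.reg 0 := by
    rw [Finset.sum_congr rfl (g := fun k => if k < e.eval σ then σ.reg 0 else 0)
      (fun k _ => by split_ifs <;> simp), ← Finset.sum_filter, Finset.sum_const, smul_eq_mul]
    congr 1
    rw [← Finset.card_range (e.eval σ)]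
    congr 1
    ext k; simp; omega
  rw [min_eq_left h2.le]
  simp only [if_true, if_false, OfNat.zero_ne_ofNat] at this ⊢
  rw [this]

/-- Adjacency of the contents of two registers. -/
def adjReg (x y : ℕ) : Exp := adj (reg x) (reg y)

/-- Adjacency of the vertices that array `1` assigns to the contents of two registers. -/
def adjOrd (x y : ℕ) : Exp := adj (load 1 (reg x)) (load 1 (reg y))

theorem T_adjReg {x y : ℕ} (hx : x ≠ 60) (σ : State) :
    (adjReg x y).T σ ↔ matrixRel (σ.reg 0) (σ.arr 0) (σ.reg x) (σ.reg y) :=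
  T_adj _ _ σ fun k => by simp [State.setReg_reg, hx]

theorem T_adjOrd {x y : ℕ} (hx : x ≠ 60) (σ : State) :
    (adjOrd x y).T σ ↔
      renumber (matrixRel (σ.reg 0) (σ.arr 0)) (σ.arr 1) (σ.reg x) (σ.reg y) :=
  T_adj _ _ σ fun k => by simp [State.setReg_reg, hx]

end Exp

/-! ### Vertices of least closure number, and searching for a least value -/

/-- The number of common neighbours of `x` and `y` in the vertex set `L`. -/
noncomputable def commonCount (A : ℕ → ℕ → Prop) (n : ℕ) (L : ℕ → Prop) (x y : ℕ) : ℕ :=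
  countBelow n fun w => L w ∧ A x w ∧ A y w

/-- The vertex `z` has the least closure number in the subgraph induced by `L`. -/
def IsBest (A : ℕ → ℕ → Prop) (n : ℕ) (L : ℕ → Prop) (z : ℕ) : Prop :=
  L z ∧ ∀ y < n, L y → ∀ u < n, L u → u ≠ z → ¬ A z u →
    ∃ u' < n, L u' ∧ u' ≠ y ∧ ¬ A y u' ∧ commonCount A n L z u ≤ commonCount A n L y u'

open Classical in
theorem exists_isBest (A : ℕ → ℕ → Prop) (n : ℕ) (L : ℕ → Prop) (hL : ∃ x < n, L x) :
    ∃ z < n, IsBest A n L z := by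
  let N : ℕ → Finset ℕ := fun z => (Finset.range n).filter fun u => L u ∧ u ≠ z ∧ ¬ A z u
  -- Adding one distinguishes a vertex without non-neighbours, of value `0`, from one whose
  -- non-neighbours share no neighbour with it.
  let f : ℕ → ℕ := fun z => (N z).sup fun u => commonCount A n L z u + 1
  obtain ⟨x, hx, hLx⟩ := hL
  obtain ⟨z, hz, hmin⟩ := Finset.exists_min_image ((Finset.range n).filter L) f
    ⟨x, Finset.mem_filter.2 ⟨Finset.mem_range.2 hx, hLx⟩⟩
  obtain ⟨hz1, hz2⟩ := Finset.mem_filter.1 hz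
  refine ⟨z, Finset.mem_range.1 hz1, hz2, fun y hy hLy u hu hLu huz hAu => ?_⟩
  have h1 : commonCount A n L z u < f z :=
    Finset.le_sup (f := fun u => commonCount A n L z u + 1)
      (Finset.mem_filter.2 ⟨Finset.mem_range.2 hu, hLu, huz, hAu⟩)
  have h2 := h1.trans_le (hmin y (Finset.mem_filter.2 ⟨Finset.mem_range.2 hy, hLy⟩))
  obtain ⟨u', hu', h3⟩ := Finset.lt_sup_iff.1 h2
  obtain ⟨h4, h5, h6, h7⟩ := Finset.mem_filter.1 hu'
  exact ⟨u', Finset.mem_range.1 h4, h5, h6, h7, by omega⟩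

/-- The numbers counted are those with no solution of `p` up to and including them. If there is no
solution below `n`, all are counted and `l = n` is the default. -/
theorem countBelow_forall_not {n : ℕ} (p : ℕ → Prop)
    {l : ℕ} (hl : l ≤ n)
    (hp : l < n → p l) (hlt : ∀ z < l, ¬ p z) :
    (countBelow n fun y => ∀ z < n, y < z ∨ ¬ p z) = l := by
  rw [countBelow, ← Finset.card_range l]
  congr 1
  ext y
  simp only [Finset.mem_filter, Finset.mem_range]
  constructor
  · rintro ⟨h1, h2⟩
    by_contra hc
    rcases h2 l (by omega) with h | h
    · omega
    · exact h (hp (by omega))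
  · intro h
    refine ⟨by omega, fun z hz => ?_⟩
    by_cases hzy : y < z
    · exact .inl hzy
    · exact .inr (hlt z (by omega))

theorem exists_first (n : ℕ) (p : ℕ → Prop) :
    ∃ l ≤ n, (l < n → p l) ∧ ∀ z < l, ¬ p z := by
  induction n with
  | zero => exact ⟨0, le_rfl, by simp, by simp⟩
  | succ n ih =>
    obtain ⟨l, h1, h2, h3⟩ := ih
    rcases h1.lt_or_eq with h | rfl
    · exact ⟨l, by omega, fun _ => h2 h, h3⟩
    · by_cases hp : p l
      · exact ⟨l, by omega, fun _ => hp, h3⟩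
      · refine ⟨l + 1, le_rfl, fun h => absurd h (lt_irrefl _), fun z hz => ?_⟩
        rcases Nat.lt_succ_iff_lt_or_eq.1 hz with h | rfl
        exacts [h3 z h, hp]

open Classical in
theorem Exp.least_spec {y z : ℕ} (hyz : y ≠ z) (hy : y ≠ 0) (e : Exp) (σ : State)
    (p : ℕ → Prop)
    (he : ∀ k j, e.T ((σ.setReg y j).setReg z k) ↔ p k) :
    (least y z e).eval σ ≤ σ.reg 0 ∧ ((least y z e).eval σ < σ.reg 0 → p ((least y z e).eval σ)) ∧
      ∀ i < (least y z e).eval σ, ¬ p i := by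
  obtain ⟨l, h1, h2, h3⟩ := exists_first (σ.reg 0) p
  have : (least y z e).eval σ = l := by
    simp only [least, eval_card, T_all, T_or, T_lt, T_neg, he, eval_reg, State.setReg_reg, if_true,
      if_neg hyz, if_neg hy.symm]
    exact countBelow_forall_not p h1 h2 h3
  rw [this]
  exact ⟨h1, h2, h3⟩

/-! ### The elimination order -/

open Exp

/-- Register `21` holds a best vertex; array `2` marks the vertices already removed. -/
def bestExp : Exp :=
  let alive : ℕ → Exp := fun x => eq (load 2 (reg x)) (const 0)
  let common : ℕ → ℕ → Exp := fun x y =>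
    card 25 (and (alive 25) (and (adjReg x 25) (adjReg y 25)))
  and (alive 21) (all 22 (or (neg (alive 22)) (all 23 (or (neg (alive 23))
    (or (eq (reg 23) (reg 21)) (or (adjReg 21 23) (ex 24 (and (alive 24)
    (and (neg (eq (reg 24) (reg 22)))
      (and (neg (adjReg 22 24)) (neg (lt (common 22 24) (common 21 23)))))))))))))

theorem T_bestExp (σ : State) : bestExp.T σ ↔
    IsBest (matrixRel (σ.reg 0) (σ.arr 0)) (σ.reg 0) (fun x => σ.arr 2 x = 0) (σ.reg 21) := by
  simp [bestExp, IsBest, T_adjReg, State.setReg_reg, commonCount, or_iff_not_imp_left]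

/-- Removal of a best vertex. -/
def orderStep : Prog :=
  .seq (.assign 11 (least 20 21 bestExp)) (.seq (.assign 16 (card 20 (lt (reg 10) (reg 20)))) (.seq
    (.store 1 (reg 16) (reg 11)) (.store 2 (reg 11) (const 1))))

/-- Computation of the elimination order, from back to front, in array `1`. -/
def orderProg : Prog := .forN 10 orderStep

/-- `o` enumerates the vertices such that each vertex but the first `m` has, among the vertices
not after it, fewer than `g` common neighbours with each non-neighbour. -/
structure IsElim (A : ℕ → ℕ → Prop) (n g m : ℕ) (o : ℕ → ℕ) : Prop where
  lt : ∀ r, m ≤ r → r < n → o r < n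
  inj : ∀ r s, m ≤ r → r < n → m ≤ s → s < n → o r = o s → r = s
  bound : ∀ r, m ≤ r → r < n → ∀ y < n, (∀ s, r ≤ s → s < n → o s ≠ y) → ¬ A (o r) y →
    commonCount A n (fun w => ∀ s, r < s → s < n → o s ≠ w) (o r) y < g

/-- Every nonempty vertex set contains a vertex of closure number less than `g`. -/
def WeaklyClosedOn (A : ℕ → ℕ → Prop) (n g : ℕ) : Prop :=
  ∀ L : ℕ → Prop, (∃ x < n, L x) → ∃ y < n, L y ∧ ∀ u < n, L u → u ≠ y → ¬ A y u →
    commonCount A n L y u < g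

theorem orderProg_spec {σ : State} {n g : ℕ} {A : ℕ → ℕ → Prop} (hn : σ.reg 0 = n)
    (hA : matrixRel n (σ.arr 0) = A) (hW : WeaklyClosedOn A n g) (h2 : ∀ x, σ.arr 2 x = 0) :
    IsElim A n g 0 ((orderProg.eval σ).arr 1) := by
  have h := (Prog.forN_inv (σ := σ) (x := 10) (p := orderStep)
    (fun k τ => τ.reg 0 = n ∧ τ.arr 0 = σ.arr 0 ∧ k ≤ n ∧
    IsElim A n g (n - k) (τ.arr 1) ∧
    ∀ x < n, τ.arr 2 x = 0 ↔ ∀ s, n - k ≤ s → s < n → τ.arr 1 s ≠ x)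
    (h0 := ?_) (h := ?_)).1
  · rw [hn, Nat.sub_self] at h
    exact h.2.2.2.1
  · refine ⟨by simpa [State.setReg_reg] using hn, rfl, by omega, ⟨?_, ?_, ?_⟩, ?_⟩
    · intros; omega
    · intros; omega
    · intros; omega
    · intro x hx
      simp only [State.setReg_arr, h2, true_iff]
      intros; omega
  · rintro k hk τ hτk ⟨h0, hτ0, -, hE, hdead⟩
    rw [hn] at hk
    -- The `k < n` positions filled so far cannot exhaust the `n` vertices.
    have hsurj : ∃ x < n, τ.arr 2 x = 0 := by
      by_contra hc
      push Not at hc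
      have hex : ∀ x ∈ Finset.range n, ∃ s ∈ Finset.Ico (n - k) n, τ.arr 1 s = x := by
        intro x hx
        have hx := Finset.mem_range.1 hx
        have := mt (hdead x hx).2 (hc x hx)
        push Not at this
        obtain ⟨s, h1, h2, h3⟩ := this
        exact ⟨s, Finset.mem_Ico.2 ⟨h1, h2⟩, h3⟩
      have := Finset.card_le_card_of_surjOn (s := Finset.Ico (n - k) n) (t := Finset.range n)
        (τ.arr 1) (fun x hx => by
          obtain ⟨s, h1, h2⟩ := hex x (by simpa using hx)
          exact ⟨s, by simpa using h1, h2⟩)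
      rw [Nat.card_Ico, Finset.card_range] at this
      omega
    set L : ℕ → Prop := fun x => τ.arr 2 x = 0 with hL
    obtain ⟨z, hz, hzb⟩ := exists_isBest A n L hsurj
    obtain ⟨l1, l2, l3⟩ := Exp.least_spec (y := 20) (z := 21) (by omega) (by omega)
      bestExp τ (IsBest A n L) (fun k j => by
        rw [T_bestExp]; simp [State.setReg_reg, h0, hτ0, hA, hL])
    rw [h0] at l1 l2
    set v := (least 20 21 bestExp).eval τ with hv
    have hvn : v < n := by
      by_contra hc
      exact l3 z (by omega) hzb
    have hvb := l2 hvn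
    -- The next position from the back is found by counting the numbers strictly between `k` and
    -- `n`.
    have hr : ∀ τ' : State, τ'.reg 0 = n → τ'.reg 10 = k →
        (card 20 (lt (reg 10) (reg 20))).eval τ' = n - (k + 1) := by
      intro τ' h0' hk'
      simp only [eval_card, T_lt, eval_reg, State.setReg_reg, h0', hk', if_true]
      rw [← Nat.sub_sub, ← Nat.card_Ioo k n, countBelow]
      congr 1
      ext y; simp; omega
    simp only [orderStep, Prog.eval, eval_reg, eval_const]
    rw [← hv, hr _ (by simp [State.setReg_reg, h0]) (by simp [State.setReg_reg, hτk])]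
    have hnew : ∀ s, ((((((τ.setReg 11 v).setReg 16 (n - (k + 1))).setArr 1 (n - (k + 1)) v).setArr
        2 v 1)).setReg 10 (k + 1)).arr 1 s = if s = n - (k + 1) then v else τ.arr 1 s := by
      intro s; simp [State.setArr_arr]
    have hnew2 : ∀ x, ((((((τ.setReg 11 v).setReg 16 (n - (k + 1))).setArr 1 (n - (k + 1)) v).setArr
        2 v 1)).setReg 10 (k + 1)).arr 2 x = if x = v then 1 else τ.arr 2 x := by
      intro s; simp [State.setArr_arr]
    have hreg : ((((((τ.setReg 11 v).setReg 16 (n - (k + 1))).setArr 1 (n - (k + 1)) v).setArr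
        2 v 1)).setReg 10 (k + 1)).reg 0 = τ.reg 0 := by
      simp [State.setReg_reg]
    have hv11 : ((((τ.setReg 11 v).setReg 16 (n - (k + 1))).setArr 1
      (n - (k + 1)) v)).reg 11 = v := by simp [State.setReg_reg]
    have hv16 : ((τ.setReg 11 v).setReg 16 (n - (k + 1))).reg 16 = n - (k + 1) := by
      simp [State.setReg_reg]
    have hv11' : ((τ.setReg 11 v).setReg 16 (n - (k + 1))).reg 11 = v := by
      simp [State.setReg_reg]
    rw [hv16, hv11', hv11]
    generalize ((((((τ.setReg 11 v).setReg 16 (n - (k + 1))).setArr 1 (n - (k + 1)) v).setArr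
        2 v 1)).setReg 10 (k + 1)).arr 2 = d' at hnew2 ⊢
    have harr0 : ((((((τ.setReg 11 v).setReg 16 (n - (k + 1))).setArr 1 (n - (k + 1)) v).setArr
        2 v 1)).setReg 10 (k + 1)).arr 0 = τ.arr 0 := by
      funext s; simp [State.setArr_arr]
    rw [harr0, hreg]
    generalize ((((((τ.setReg 11 v).setReg 16 (n - (k + 1))).setArr 1 (n - (k + 1)) v).setArr
        2 v 1)).setReg 10 (k + 1)).arr 1 = o' at hnew ⊢
    have ho' : ∀ s, n - k ≤ s → s < n → o' s = τ.arr 1 s := by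
      intro s h1 h2; rw [hnew, if_neg (by omega)]
    have hor : o' (n - (k + 1)) = v := by rw [hnew, if_pos rfl]
    have hvL : ∀ s, n - k ≤ s → s < n → τ.arr 1 s ≠ v := (hdead v hvn).1 hvb.1
    refine ⟨h0, hτ0, by omega, ⟨?_, ?_, ?_⟩, ?_⟩
    · intro r h1 h2
      rcases h1.lt_or_eq with h | rfl
      · rw [ho' r (by omega) h2]; exact hE.lt r (by omega) h2
      · rwa [hor]
    · intro r s h1 h2 h3 h4
      rcases h1.lt_or_eq with h | rfl
      · rcases h3.lt_or_eq with h' | rfl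
        · rw [ho' r (by omega) h2, ho' s (by omega) h4]
          exact hE.inj r s (by omega) h2 (by omega) h4
        · rw [ho' r (by omega) h2, hor]
          exact fun hc => absurd hc (hvL r (by omega) h2)
      · rcases h3.lt_or_eq with h' | rfl
        · rw [ho' s (by omega) h4, hor]
          exact fun hc => absurd hc.symm (hvL s (by omega) h4)
        · exact fun _ => rfl
    · intro r h1 h2 y hy hys hAy
      rcases h1.lt_or_eq with h | rfl
      · have := hE.bound r (by omega) h2 y hy
          (fun s a b => by rw [← ho' s (by omega) b]; exact hys s a b)
          (by rwa [← ho' r (by omega) h2])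
        rw [ho' r (by omega) h2]
        have hw : (fun w => ∀ s, r < s → s < n → o' s ≠ w) =
            fun w => ∀ s, r < s → s < n → τ.arr 1 s ≠ w := by
          funext w
          refine propext (forall_congr' fun s => forall_congr' fun a => forall_congr' fun b => ?_)
          rw [ho' s (by omega) b]
        rwa [hw]
      · have hyL : L y := (hdead y hy).2 fun s a b => by
          rw [← ho' s a b]; exact hys s (by omega) b
        have hyv : y ≠ v := fun hc => hys (n - (k + 1)) le_rfl h2 (by rw [hor, hc])
        rw [hor] at hAy ⊢
        -- The vertex `y0` supplied by weak closedness may differ from `v`, but every count at the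
        -- best vertex `v` is dominated by one at `y0`.
        obtain ⟨y0, hy0, hLy0, hb⟩ := hW L hsurj
        obtain ⟨u', a1, a2, a3, a4, a5⟩ := hvb.2 y0 hy0 hLy0 y hy hyL hyv hAy
        refine lt_of_eq_of_lt ?_ (a5.trans_lt (hb u' a1 a2 a3 a4))
        refine countBelow_congr fun w hw => and_congr_left' ?_
        rw [hL]
        simp only
        rw [hdead w hw]
        refine forall_congr' fun s => ⟨fun H a b => ?_, fun H a b => ?_⟩
        · rw [← ho' s a b]; exact H (by omega) b
        · rw [ho' s (by omega) b]; exact H (by omega) b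
    · intro x hx
      rw [hnew2]
      constructor
      · intro hd s a b
        rcases a.lt_or_eq with h | rfl
        · rw [ho' s (by omega) b]
          refine (hdead x hx).1 ?_ s (by omega) b
          split_ifs at hd; exact hd
        · rw [hor]; rintro rfl; simp at hd
      · intro H
        rw [if_neg fun hc => H (n - (k + 1)) le_rfl (by omega) (by rw [hor, hc])]
        exact (hdead x hx).2 fun s a b => by rw [← ho' s a b]; exact H s (by omega) b

open Classical in
-- Fewer than `g` common neighbours, and `v` itself in addition: at most `g` in all.
theorem IsElim.card_candidates {A : ℕ → ℕ → Prop} {n g : ℕ} {o : ℕ → ℕ} (h : IsElim A n g 0 o)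
    {v u : ℕ} (hvu : IsSeed (renumber A o) n v u) :
    ((Finset.range n).filter (InCandidates (renumber A o) v u)).card ≤ g := by
  obtain ⟨hv, hu, hA⟩ := hvu
  have hb := h.bound v (by omega) hv (o u) (h.lt u (by omega) (by omega))
    (fun s a b c => by have := h.inj s u (by omega) b (by omega) (by omega) c; omega) hA
  have : (Finset.range n).filter (InCandidates (renumber A o) v u) ⊆
      insert v ((Finset.range n).filter fun x => x ≤ v ∧ A (o v) (o x) ∧ A (o u) (o x)) := by
    intro x hx
    obtain ⟨h1, h2⟩ := Finset.mem_filter.1 hx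
    rcases h2 with h2 | h2
    · exact Finset.mem_insert.2 (.inl h2)
    · exact Finset.mem_insert.2 (.inr (Finset.mem_filter.2 ⟨h1, h2⟩))
  refine (Finset.card_le_card this).trans ((Finset.card_insert_le _ _).trans ?_)
  refine Nat.succ_le_of_lt (lt_of_le_of_lt ?_ hb)
  rw [commonCount, countBelow]
  refine Finset.card_le_card_of_injOn o ?_ ?_
  · intro x hx
    obtain ⟨h1, h2, h3, h4⟩ := Finset.mem_filter.1 hx
    have hxn := Finset.mem_range.1 h1
    simp only [Finset.coe_filter, Set.mem_ofPred_eq, Finset.mem_range]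
    refine ⟨h.lt x (by omega) hxn, fun s a b c => ?_, h3, h4⟩
    have := h.inj s x (by omega) b (by omega) hxn c
    omega
  · intro x hx y hy hxy
    have hx := Finset.mem_range.1 (Finset.mem_filter.1 hx).1
    have hy := Finset.mem_range.1 (Finset.mem_filter.1 hy).1
    exact h.inj x y (by omega) hx (by omega) hy hxy

end RAM

namespace RAM

open Biclique Exp

/-! ### The search program

Registers `1` and `2` hold the numbers of the instance, `3` the result, `4` and `5` the sizes of the
two sides, `6` is set when the search is over, `7` holds the length of the masks, `11` and `12` hold
the pair of vertices and `13` the threshold. Array `1` holds the elimination order, `3` the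
labelling and `4` the mask. -/

/-- The adjacency relation after renumbering by the elimination order. -/
def relOf (σ : State) : ℕ → ℕ → Prop :=
  renumber (matrixRel (σ.reg 0) (σ.arr 0)) (σ.arr 1)

theorem relOf_setReg {x : ℕ} (hx : x ≠ 0) (σ : State) (k : ℕ) :
    relOf (σ.setReg x k) = relOf σ := by
  simp [relOf, State.setReg_reg, hx.symm]

theorem relOf_congr {σ τ : State} (h : τ.reg 0 = σ.reg 0) (h0 : τ.arr 0 = σ.arr 0)
    (h1 : τ.arr 1 = σ.arr 1) : relOf τ = relOf σ := by
  rw [relOf, relOf, h, h0, h1]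

/-- The mask stored in array `4`. -/
def maskOf (σ : State) (i : ℕ) : Prop := σ.arr 4 i ≠ 0

theorem maskOf_setReg (σ : State) (x k : ℕ) : maskOf (σ.setReg x k) = maskOf σ := rfl

def candExp (x : ℕ) : Exp :=
  or (eq (reg x) (reg 11)) (and (neg (lt (reg 11) (reg x))) (and (adjOrd 11 x) (adjOrd 12 x)))

theorem T_candExp (x : ℕ) (σ : State) :
    (candExp x).T σ ↔ InCandidates (relOf σ) (σ.reg 11) (σ.reg 12) (σ.reg x) := by
  simp [candExp, InCandidates, T_adjOrd, relOf]

def rankExp (x : ℕ) : Exp := card 22 (and (candExp 22) (lt (reg 22) (reg x)))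

theorem eval_rankExp {x : ℕ} (hx : x ≠ 22) (σ : State) :
    (rankExp x).eval σ = rank (relOf σ) (σ.reg 0) (σ.reg 11) (σ.reg 12) (σ.reg x) := by
  simp [rankExp, rank, card_filter_range, T_candExp, State.setReg_reg, relOf_setReg, hx]

def chosenExp (x : ℕ) : Exp := and (candExp x) (load 4 (rankExp x))

theorem T_chosenExp {x : ℕ} (hx : x ≠ 22) (σ : State) :
    (chosenExp x).T σ ↔
      Chosen (relOf σ) (σ.reg 0) (maskOf σ) (σ.reg 11) (σ.reg 12) (σ.reg x) := by
  simp [chosenExp, Chosen, T_candExp, eval_rankExp hx, maskOf]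

def seedExp : Exp :=
  and (lt (reg 11) (reg 0)) (and (lt (reg 12) (reg 11)) (neg (adjOrd 11 12)))

theorem T_seedExp (σ : State) :
    seedExp.T σ ↔ IsSeed (relOf σ) (σ.reg 0) (σ.reg 11) (σ.reg 12) := by
  simp [seedExp, IsSeed, T_adjOrd, relOf]

def startExp : Exp :=
  cond seedExp (cond (chosenExp 15) (const 1)
    (cond (and (neg (lt (reg 11) (reg 15))) (all 23 (or (neg (chosenExp 23)) (adjOrd 15 23))))
      (const 2) (const 0))) (const 0)

theorem eval_startExp (σ : State) : startExp.eval σ =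
    startLabel (relOf σ) (σ.reg 0) (maskOf σ) (σ.reg 11) (σ.reg 12) (σ.reg 15) := by
  have h : ∀ k, (adjOrd 15 23).T (σ.setReg 23 k) ↔ relOf σ (σ.reg 15) k := fun k => by
    simp [T_adjOrd, relOf, State.setReg_reg]
  have h' : ∀ k, (chosenExp 23).T (σ.setReg 23 k) ↔
      Chosen (relOf σ) (σ.reg 0) (maskOf σ) (σ.reg 11) (σ.reg 12) k := fun k => by
    rw [T_chosenExp (by omega), relOf_setReg (by omega)]
    simp [State.setReg_reg, maskOf_setReg]
  have h₁ := T_seedExp σ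
  have h₂ := T_chosenExp (x := 15) (by omega) σ
  have h₃ : (and (neg (lt (reg 11) (reg 15)))
      (all 23 (or (neg (chosenExp 23)) (adjOrd 15 23)))).T σ ↔ σ.reg 15 ≤ σ.reg 11 ∧
        ∀ y < σ.reg 0, Chosen (relOf σ) (σ.reg 0) (maskOf σ) (σ.reg 11) (σ.reg 12) y →
          relOf σ (σ.reg 15) y := by
    simp only [T_and, T_neg, T_lt, T_all, T_or, h, h', eval_reg, not_lt, imp_iff_not_or]
  simp only [startExp, eval_cond, eval_const, startLabel, seedLabel]
  congr
  exacts [propext h₁, propext h₂, propext h₃]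

def extendExp : Exp :=
  cond (and (neg (lt (reg 15) (cond seedExp (succ (reg 11)) (const 0))))
    (all 23 (or (eq (load 3 (reg 23)) (const 0)) (adjOrd 15 23)))) (const 3) (load 3 (reg 15))

open Classical in
theorem eval_extendExp (σ : State) : extendExp.eval σ =
    if startThr (relOf σ) (σ.reg 0) (σ.reg 11) (σ.reg 12) ≤ σ.reg 15 ∧
      ∀ y < σ.reg 0, σ.arr 3 y ≠ 0 → relOf σ (σ.reg 15) y then 3 else σ.arr 3 (σ.reg 15) := by
  have h : ∀ k, (adjOrd 15 23).T (σ.setReg 23 k) ↔ relOf σ (σ.reg 15) k := fun k => by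
    simp [T_adjOrd, relOf, State.setReg_reg]
  have hs : (succ (reg 11)).eval σ = σ.reg 11 + 1 := rfl
  simp only [extendExp, eval_cond, T_and, T_neg, T_lt, T_seedExp, T_all, T_or, T_eq, h, eval_const,
    eval_reg, eval_load, hs, startThr, not_lt, State.setReg_reg, State.setReg_arr, if_true,
    or_iff_not_imp_left, ne_eq]
  congr

def sideTwoExp : Exp :=
  card 15 (or (eq (load 3 (reg 15)) (const 2))
    (and (eq (load 3 (reg 15)) (const 3)) (lt (reg 15) (reg 13))))

def sideOneExp : Exp :=
  card 15 (or (eq (load 3 (reg 15)) (const 1))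
    (and (eq (load 3 (reg 15)) (const 3)) (neg (lt (reg 15) (reg 13)))))

theorem eval_sideTwoExp (σ : State) :
    sideTwoExp.eval σ = sideTwo (σ.reg 0) (σ.arr 3) (σ.reg 13) := by
  simp [sideTwoExp, sideTwo, card_filter_range, State.setReg_reg]

theorem eval_sideOneExp (σ : State) :
    sideOneExp.eval σ = sideOne (σ.reg 0) (σ.arr 3) (σ.reg 13) := by
  simp [sideOneExp, sideOne, card_filter_range, State.setReg_reg]

theorem sideTwo_congr {n : ℕ} {B B' : ℕ → ℕ} (h : ∀ x < n, B x = B' x) (c : ℕ) :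
    sideTwo n B c = sideTwo n B' c := by
  unfold sideTwo
  rw [card_filter_range, card_filter_range]
  exact countBelow_congr fun k hk => by rw [h k hk]

theorem sideOne_congr {n : ℕ} {B B' : ℕ → ℕ} (h : ∀ x < n, B x = B' x) (c : ℕ) :
    sideOne n B c = sideOne n B' c := by
  unfold sideOne
  rw [card_filter_range, card_filter_range]
  exact countBelow_congr fun k hk => by rw [h k hk]

theorem sideTwo_le (n : ℕ) (B : ℕ → ℕ) (c : ℕ) : sideTwo n B c ≤ n :=
  (Finset.card_filter_le _ _).trans (Finset.card_range n).le

theorem sideOne_le (n : ℕ) (B : ℕ → ℕ) (c : ℕ) : sideOne n B c ≤ n :=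
  (Finset.card_filter_le _ _).trans (Finset.card_range n).le

/-- An expression for the predicate `P` of registers `1`, `2`, `4` and `5`, where the last two are
at most `n`. -/
def Expresses (e : Exp) (P : ℕ → ℕ → ℕ → ℕ → Prop) : Prop :=
  ∀ σ : State, σ.reg 4 ≤ σ.reg 0 → σ.reg 5 ≤ σ.reg 0 →
    (e.T σ ↔ P (σ.reg 1) (σ.reg 2) (σ.reg 4) (σ.reg 5))

def sidesProg (e : Exp) : Prog :=
  .seq (.assign 4 sideTwoExp) (.seq (.assign 5 sideOneExp)
    (.assign 3 (cond (or (reg 3) e) (const 1) (const 0))))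

theorem sidesProg_spec {e : Exp} {P : ℕ → ℕ → ℕ → ℕ → Prop} (he : Expresses e P) (σ : State) :
    ((sidesProg e).eval σ).reg 3 ≠ 0 ↔ σ.reg 3 ≠ 0 ∨ P (σ.reg 1) (σ.reg 2)
      (sideTwo (σ.reg 0) (σ.arr 3) (σ.reg 13)) (sideOne (σ.reg 0) (σ.arr 3) (σ.reg 13)) := by
  simp only [sidesProg, Prog.eval]
  set τ := (σ.setReg 4 (sideTwoExp.eval σ)).setReg 5
    (sideOneExp.eval (σ.setReg 4 (sideTwoExp.eval σ))) with hτ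
  have h0 : τ.reg 0 = σ.reg 0 := by simp [hτ, State.setReg_reg]
  have h1 : τ.reg 1 = σ.reg 1 := by simp [hτ, State.setReg_reg]
  have h2 : τ.reg 2 = σ.reg 2 := by simp [hτ, State.setReg_reg]
  have h3 : τ.reg 3 = σ.reg 3 := by simp [hτ, State.setReg_reg]
  have h4 : τ.reg 4 = sideTwo (σ.reg 0) (σ.arr 3) (σ.reg 13) := by
    simp [hτ, State.setReg_reg, eval_sideTwoExp]
  have h5 : τ.reg 5 = sideOne (σ.reg 0) (σ.arr 3) (σ.reg 13) := by
    simp [hτ, State.setReg_reg, eval_sideOneExp]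
  have := he τ (by rw [h4, h0]; exact sideTwo_le _ _ _) (by rw [h5, h0]; exact sideOne_le _ _ _)
  rw [h1, h2, h4, h5] at this
  simp only [State.setReg_reg, if_true, eval_cond, eval_const]
  split_ifs with h <;> rw [T_or, T_reg, h3, this] at h <;> simpa using h

/-! ### Building the labellings and running through pairs and thresholds -/

/-- Fill array `a` with the values of `e` for the values `0, …, n - 1` of register `x`. -/
def fillProg (x a : ℕ) (e : Exp) : Prog := .forN x (.store a (reg x) e)

/-- The expression may read the array being filled, so the invariant concerns its current, partly
updated content. -/
theorem fillProg_inv {x a : ℕ} {e : Exp} (σ : State) (I : ℕ → (ℕ → ℕ) → Prop)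
    (h0 : I 0 (σ.arr a))
    (hs : ∀ k < σ.reg 0, ∀ τ : State, τ.reg x = k → (∀ y, y ≠ x → τ.reg y = σ.reg y) →
      (∀ b, b ≠ a → τ.arr b = σ.arr b) → I k (τ.arr a) →
      I (k + 1) (Function.update (τ.arr a) k (e.eval τ))) :
    I (σ.reg 0) (((fillProg x a e).eval σ).arr a) := by
  have h := (Prog.forN_inv (σ := σ) (x := x) (p := .store a (reg x) e) (fun k τ =>
    (∀ y, y ≠ x → τ.reg y = σ.reg y) ∧ (∀ b, b ≠ a → τ.arr b = σ.arr b) ∧ I k (τ.arr a))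
    ⟨fun y hy => by simp [State.setReg_reg, hy], fun b _ => rfl, h0⟩
    (fun k hk τ hτ ⟨h1, h2, h3⟩ => ⟨fun y hy => by simp [State.setReg_reg, hy, Prog.eval, h1 y hy],
      fun b hb => ?_, ?_⟩)).1
  · exact h.2.2
  · rw [State.setReg_arr, ← h2 b hb]
    funext i
    simp [Prog.eval, State.setArr_arr, hb]
  · have := hs k hk τ hτ h1 h2 h3
    simpa [Prog.eval, State.setArr, hτ] using this

/-- Construction of the labelling, and test of all ways to choose sides. -/
def labelProg (e : Exp) : Prog :=
  .seq (fillProg 15 3 startExp) (.seq (fillProg 15 3 extendExp)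
    (.seq (.forN 13 (sidesProg e)) (sidesProg e)))

theorem labelProg_spec {e : Exp} {P : ℕ → ℕ → ℕ → ℕ → Prop} (he : Expresses e P) (σ : State)
    {k : ℕ} (hk : maskOf σ = maskBit k) :
    ((labelProg e).eval σ).reg 3 ≠ 0 ↔ σ.reg 3 ≠ 0 ∨
      Success (relOf σ) (σ.reg 0) (P (σ.reg 1) (σ.reg 2)) k (σ.reg 11) (σ.reg 12) := by
  set n := σ.reg 0 with hn
  set B := startLabel (relOf σ) n (maskBit k) (σ.reg 11) (σ.reg 12) with hB
  set thr := startThr (relOf σ) n (σ.reg 11) (σ.reg 12) with hthr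
  simp only [labelProg, Prog.eval.eq_3]
  set σ₁ := (fillProg 15 3 startExp).eval σ with hσ₁
  have r₁ : ∀ y, y ≠ 15 → σ₁.reg y = σ.reg y := fun y hy =>
    Prog.eval_reg _ _ (by simpa [fillProg, Prog.regs] using hy)
  have a₁ : ∀ a, a ≠ 3 → σ₁.arr a = σ.arr a := fun a ha =>
    Prog.eval_arr _ _ (by simpa [fillProg, Prog.arrs] using ha)
  have l₁ : ∀ x < n, σ₁.arr 3 x = B x := by
    refine fillProg_inv (x := 15) (a := 3) (e := startExp) σ
      (fun m L => ∀ x < m, L x = B x) (by intros; omega) ?_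
    intro m hm τ hτ hr ha hI x hx
    rw [Function.update_apply]
    split_ifs with hxm
    · rw [eval_startExp, relOf_congr (hr 0 (by omega)) (ha 0 (by omega)) (ha 1 (by omega)),
        hr 0 (by omega), hr 11 (by omega), hr 12 (by omega), hτ, hB, ← hn, hxm]
      congr 1
      rw [← hk]
      unfold maskOf
      rw [ha 4 (by omega)]
    · exact hI x (by omega)
  set σ₂ := (fillProg 15 3 extendExp).eval σ₁ with hσ₂
  have r₂ : ∀ y, y ≠ 15 → σ₂.reg y = σ.reg y := fun y hy =>
    (Prog.eval_reg _ _ (by simpa [fillProg, Prog.regs] using hy)).trans (r₁ y hy)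
  have l₂ : ∀ x < n, σ₂.arr 3 x = fullLabel (relOf σ) n (maskBit k) (σ.reg 11) (σ.reg 12) x := by
    -- The update in place is the recursion of `extend`: step `m` sees the labels already changed by
    -- the earlier steps.
    have h := fillProg_inv (x := 15) (a := 3) (e := extendExp) σ₁
      (fun m L => ∀ x < n, L x = extend (relOf σ) n thr B m x) l₁ ?_
    · rwa [r₁ 0 (by omega)] at h
    intro m hm τ hτ hr ha hI x hx
    have h0 : τ.reg 0 = n := by rw [hr 0 (by omega), r₁ 0 (by omega)]
    have hrel : relOf τ = relOf σ := relOf_congr h0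
      ((ha 0 (by omega)).trans (a₁ 0 (by omega))) ((ha 1 (by omega)).trans (a₁ 1 (by omega)))
    rw [r₁ 0 (by omega)] at hm
    rw [extend, extendStep, Function.update_apply, Function.update_apply]
    split_ifs with hxm hc
    · rw [eval_extendExp, hrel, h0, hr 11 (by omega), hr 12 (by omega), r₁ 11 (by omega),
        r₁ 12 (by omega), hτ, if_pos]
      exact ⟨hc.1, fun y hy hy0 => hc.2 y hy (by rwa [← hI y hy])⟩
    · rw [eval_extendExp, hrel, h0, hr 11 (by omega), hr 12 (by omega), r₁ 11 (by omega),
        r₁ 12 (by omega), hτ, if_neg, hI m hm]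
      exact fun hc' => hc ⟨hc'.1, fun y hy hy0 => hc'.2 y hy (by rwa [hI y hy])⟩
    · exact hI x hx
  have key : ∀ τ : State, (∀ y ∈ [0, 1, 2], τ.reg y = σ.reg y) → τ.arr 3 = σ₂.arr 3 →
      (((sidesProg e).eval τ).reg 3 ≠ 0 ↔ τ.reg 3 ≠ 0 ∨ P (σ.reg 1) (σ.reg 2)
        (sideTwo n (fullLabel (relOf σ) n (maskBit k) (σ.reg 11) (σ.reg 12)) (τ.reg 13))
        (sideOne n (fullLabel (relOf σ) n (maskBit k) (σ.reg 11) (σ.reg 12)) (τ.reg 13))) := by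
    intro τ hr ha
    rw [sidesProg_spec he, hr 0 (by simp), hr 1 (by simp), hr 2 (by simp), ha,
      sideTwo_congr l₂, sideOne_congr l₂]
  obtain ⟨⟨h1, h2, h3⟩, h4⟩ := Prog.forN_inv (σ := σ₂) (x := 13) (p := sidesProg e) (fun m τ =>
    (∀ y ∈ [0, 1, 2], τ.reg y = σ.reg y) ∧ τ.arr 3 = σ₂.arr 3 ∧
    (τ.reg 3 ≠ 0 ↔ σ.reg 3 ≠ 0 ∨ ∃ c < m, P (σ.reg 1) (σ.reg 2)
        (sideTwo n (fullLabel (relOf σ) n (maskBit k) (σ.reg 11) (σ.reg 12)) c)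
        (sideOne n (fullLabel (relOf σ) n (maskBit k) (σ.reg 11) (σ.reg 12)) c)))
    (by
      refine ⟨fun y hy => ?_, rfl, ?_⟩
      · rw [State.setReg_reg, if_neg, r₂ y]
        all_goals rintro rfl; simp at hy
      · rw [State.setReg_reg, if_neg (by omega), r₂ 3 (by omega)]
        simp)
    (by
      intro m hm τ hτ ⟨h1, h2, h3⟩
      refine ⟨fun y hy => ?_, ?_, ?_⟩
      · rw [State.setReg_reg, if_neg, Prog.eval_reg, h1 y hy]
        · simp only [sidesProg, Prog.regs]
          fin_cases hy <;> simp
        · rintro rfl; simp at hy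
      · rw [State.setReg_arr, Prog.eval_arr _ _ (by simp [sidesProg, Prog.arrs]), h2]
      · rw [State.setReg_reg, if_neg (by omega), key τ h1 h2, h3, hτ, or_assoc]
        refine or_congr_right ?_
        simp only [Nat.lt_succ_iff_lt_or_eq, or_and_right, exists_or, exists_eq_left])
  -- The loop leaves `n` in register `13`, so the final copy of `sidesProg` tests the remaining
  -- threshold `c = n`.
  rw [key _ h1 h2, h3, h4, r₂ 0 (by omega), ← hn, or_assoc, Success]
  refine or_congr_right ?_
  simp only [Nat.le_iff_lt_or_eq, or_and_right, exists_or, exists_eq_left]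

/-- The search for a fixed mask. -/
def searchProg (e : Exp) : Prog :=
  .seq (.forN 11 (.forN 12 (labelProg e))) (labelProg e)

theorem labelProg_regs (e : Exp) : (labelProg e).regs = [15, 15, 13, 4, 5, 3, 4, 5, 3] := rfl

theorem labelProg_arrs (e : Exp) : (labelProg e).arrs = [3, 3] := rfl

theorem searchProg_spec {e : Exp} {P : ℕ → ℕ → ℕ → ℕ → Prop} (he : Expresses e P) (σ : State)
    {k : ℕ} (hk : maskOf σ = maskBit k) :
    ((searchProg e).eval σ).reg 3 ≠ 0 ↔ σ.reg 3 ≠ 0 ∨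
      (∃ v < σ.reg 0, ∃ u < σ.reg 0,
        Success (relOf σ) (σ.reg 0) (P (σ.reg 1) (σ.reg 2)) k v u) ∨
      Success (relOf σ) (σ.reg 0) (P (σ.reg 1) (σ.reg 2)) k (σ.reg 0) 0 := by
  set n := σ.reg 0 with hn
  set A := relOf σ with hA
  let F : State → Prop := fun τ => (∀ y ∈ [0, 1, 2], τ.reg y = σ.reg y) ∧
    ∀ a ∈ [0, 1, 4], τ.arr a = σ.arr a
  have key : ∀ τ, F τ → (((labelProg e).eval τ).reg 3 ≠ 0 ↔ τ.reg 3 ≠ 0 ∨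
      Success A n (P (σ.reg 1) (σ.reg 2)) k (τ.reg 11) (τ.reg 12)) := by
    intro τ ⟨h1, h2⟩
    have hm : maskOf τ = maskBit k := by
      rw [← hk]; unfold maskOf; rw [h2 4 (by simp)]
    rw [labelProg_spec he τ hm, h1 0 (by simp), h1 1 (by simp), h1 2 (by simp),
      relOf_congr (h1 0 (by simp)) (h2 0 (by simp)) (h2 1 (by simp))]
  have hF : ∀ τ, F τ → F ((labelProg e).eval τ) := by
    intro τ ⟨h1, h2⟩
    refine ⟨fun y hy => ?_, fun a ha => ?_⟩
    · rw [Prog.eval_reg, h1 y hy]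
      rw [labelProg_regs]
      fin_cases hy <;> simp
    · rw [Prog.eval_arr, h2 a ha]
      rw [labelProg_arrs]
      fin_cases ha <;> simp
  have hF' : ∀ τ x c, x ∉ [0, 1, 2] → F τ → F (τ.setReg x c) := by
    intro τ x c hx ⟨h1, h2⟩
    refine ⟨fun y hy => ?_, h2⟩
    rw [State.setReg_reg, if_neg (by rintro rfl; exact hx hy), h1 y hy]
  have hinner : ∀ τ, F τ → F ((Prog.forN 12 (labelProg e)).eval τ) ∧
      (((Prog.forN 12 (labelProg e)).eval τ).reg 3 ≠ 0 ↔ τ.reg 3 ≠ 0 ∨ ∃ u < n,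
        Success A n (P (σ.reg 1) (σ.reg 2)) k (τ.reg 11) u) := by
    intro τ hτ
    have hτ0 : τ.reg 0 = n := hτ.1 0 (by simp)
    have h := (Prog.forN_inv (σ := τ) (x := 12) (p := labelProg e) (fun m υ => F υ ∧
      υ.reg 11 = τ.reg 11 ∧ (υ.reg 3 ≠ 0 ↔ τ.reg 3 ≠ 0 ∨ ∃ u < m,
        Success A n (P (σ.reg 1) (σ.reg 2)) k (τ.reg 11) u))
      ⟨hF' _ _ _ (by simp) hτ, by simp [State.setReg_reg], by simp [State.setReg_reg]⟩
      (by
        intro m hm υ hυ ⟨h1, h2, h3⟩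
        refine ⟨hF' _ _ _ (by simp) (hF _ h1), ?_, ?_⟩
        · rw [State.setReg_reg, if_neg (by omega), Prog.eval_reg _ _ (by simp [labelProg_regs]), h2]
        · rw [State.setReg_reg, if_neg (by omega), key υ h1, h3, h2, hυ, or_assoc]
          refine or_congr_right ?_
          simp only [Nat.lt_succ_iff_lt_or_eq, or_and_right, exists_or, exists_eq_left])).1
    rw [hτ0] at h
    exact ⟨h.1, h.2.2⟩
  obtain ⟨⟨h1, h2⟩, h3⟩ := Prog.forN_inv (σ := σ) (x := 11) (p := .forN 12 (labelProg e))
    (fun m τ => F τ ∧ (τ.reg 3 ≠ 0 ↔ σ.reg 3 ≠ 0 ∨ ∃ v < m, ∃ u < n,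
        Success A n (P (σ.reg 1) (σ.reg 2)) k v u))
    ⟨hF' _ _ _ (by simp) ⟨fun _ _ => rfl, fun _ _ => rfl⟩, by simp [State.setReg_reg]⟩
    (by
      intro m hm τ hτ ⟨h1, h2⟩
      refine ⟨hF' _ _ _ (by simp) (hinner τ h1).1, ?_⟩
      rw [State.setReg_reg, if_neg (by omega), (hinner τ h1).2, h2, hτ, or_assoc]
      refine or_congr_right ?_
      simp only [Nat.lt_succ_iff_lt_or_eq, or_and_right, exists_or, exists_eq_left])
  -- Likewise register `11` is left at `n`, so the final copy of `labelProg` treats the empty start;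
  -- what register `12` holds is irrelevant.
  rw [searchProg, Prog.eval, key _ h1, h2, h3, or_assoc]
  refine or_congr_right (or_congr_right ?_)
  unfold Success
  rw [fullLabel_last (maskBit k) (maskBit k) _ 0]

/-! #### Enumeration of the masks -/

/-- Binary carry: the last `l + 1` digits `01…1` become `10…0`, and the higher ones stay. -/
theorem testBit_succ {k l : ℕ} (h0 : k.testBit l = false) (h1 : ∀ i < l, k.testBit i = true)
    (i : ℕ) : (k + 1).testBit i = if i < l then false else if i = l then true else k.testBit i := by
  have hmod : k % 2 ^ (l + 1) = 2 ^ l - 1 := by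
    refine Nat.eq_of_testBit_eq fun j => ?_
    rw [Nat.testBit_mod_two_pow, Nat.testBit_two_pow_sub_one]
    rcases lt_trichotomy j l with h | rfl | h
    · simp [h1 j h, h]; omega
    · simp [h0]
    · have : ¬ j < l + 1 := by omega
      have : ¬ j < l := by omega
      simp [*]
  have hpos : 0 < 2 ^ l := by positivity
  have hlt : 2 ^ l < 2 ^ (l + 1) := by rw [pow_succ]; omega
  have hk : k + 1 = 2 ^ (l + 1) * (k / 2 ^ (l + 1)) + 2 ^ l := by
    have := Nat.div_add_mod k (2 ^ (l + 1)); omega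
  have hk' : k = 2 ^ (l + 1) * (k / 2 ^ (l + 1)) + (2 ^ l - 1) := by
    have := Nat.div_add_mod k (2 ^ (l + 1)); omega
  rw [hk, Nat.testBit_two_pow_mul_add _ hlt]
  conv_rhs => rw [hk', Nat.testBit_two_pow_mul_add _ (by omega)]
  rcases lt_trichotomy i l with h | rfl | h
  · rw [if_pos (by omega), if_pos h, Nat.testBit_two_pow_of_ne (by omega)]
  · simp
  · rw [if_neg (by omega), if_neg (by omega), if_neg (by omega), if_neg (by omega)]

theorem eq_of_testBit_all {k g : ℕ} (hk : k < 2 ^ g) (h : ∀ i < g, k.testBit i = true) :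
    k + 1 = 2 ^ g := by
  have : k = 2 ^ g - 1 := by
    refine Nat.eq_of_testBit_eq fun j => ?_
    rw [Nat.testBit_two_pow_sub_one]
    by_cases hj : j < g
    · simp [h j hj, hj]
    · simp [hj, Nat.testBit_lt_two_pow (hk.trans_le (Nat.pow_le_pow_right two_pos (not_lt.1 hj)))]
  have : 0 < 2 ^ g := by positivity
  omega

/-- Replacement of the mask by the next one; register `14` holds the position of its lowest zero. -/
def nextProg : Prog :=
  .seq (.assign 14 (least 20 21 (eq (load 4 (reg 21)) (const 0))))
    (.seq (.assign 6 (cond (lt (reg 14) (reg 7)) (const 0) (const 1)))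
      (fillProg 15 4 (cond (lt (reg 15) (reg 14)) (const 0)
        (cond (eq (reg 15) (reg 14)) (const 1) (load 4 (reg 15))))))

theorem nextProg_spec {σ : State} {k g : ℕ} (hg : σ.reg 7 = g) (hgn : g ≤ σ.reg 0)
    (hk : k < 2 ^ g) (hm : maskOf σ = maskBit k) :
    (nextProg.eval σ).reg 6 = (if k + 1 < 2 ^ g then 0 else 1) ∧
      (k + 1 < 2 ^ g → maskOf (nextProg.eval σ) = maskBit (k + 1)) := by
  have hbit : ∀ i, σ.arr 4 i = 0 ↔ k.testBit i = false := by
    intro i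
    have := congrFun hm i
    simp only [maskOf, maskBit, ne_eq, eq_iff_iff] at this
    rw [← not_iff_not, this]; simp
  obtain ⟨l1, l2, l3⟩ := Exp.least_spec (y := 20) (z := 21) (by omega) (by omega)
    (eq (load 4 (reg 21)) (const 0)) σ (fun i => σ.arr 4 i = 0)
    (fun k j => by simp [State.setReg_reg])
  simp only [nextProg, Prog.eval.eq_3]
  set l := (least 20 21 (eq (load 4 (reg 21)) (const 0))).eval σ
  have e1 : (Prog.assign 14 (least 20 21 (eq (load 4 (reg 21)) (const 0)))).eval σ =
    σ.setReg 14 l := rfl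
  rw [e1]
  clear e1
  clear_value l
  set d := if l < g then 0 else 1 with hd
  have e2 : (Prog.assign 6 (cond (lt (reg 14) (reg 7)) (const 0) (const 1))).eval
      (σ.setReg 14 l) = (σ.setReg 14 l).setReg 6 d := by
    simp only [Prog.eval, eval_cond, T_lt, eval_reg, State.setReg_reg, eval_const]
    simp [hg, hd]
  rw [e2]
  -- The lowest zero lies outside the first `g` digits exactly for the last mask, which consists of
  -- ones.
  have hdone : l < g ↔ k + 1 < 2 ^ g := by
    constructor
    · intro hlg
      have h0 := l2 (by omega)
      rw [hbit] at h0
      by_contra hc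
      have hk' : k = 2 ^ g - 1 := by omega
      rw [hk', Nat.testBit_two_pow_sub_one] at h0
      simp [hlg] at h0
    · intro hlt
      by_contra hc
      have := eq_of_testBit_all hk (fun i hi => by
        have := l3 i (by omega)
        rw [hbit] at this
        simpa using this)
      omega
  refine ⟨?_, fun hlt => ?_⟩
  · rw [Prog.eval_reg _ _ (by simp [fillProg, Prog.regs]), State.setReg_reg, if_pos rfl, hd]
    simp only [hdone]
  · have hlg := hdone.2 hlt
    have hln : l < σ.reg 0 := by omega
    have hfill := fillProg_inv (x := 15) (a := 4) (e := cond (lt (reg 15) (reg 14)) (const 0)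
        (cond (eq (reg 15) (reg 14)) (const 1) (load 4 (reg 15))))
      ((σ.setReg 14 l).setReg 6 d)
      (fun m L => ∀ i, L i = if i < m then (if i < l then 0 else if i = l then 1 else σ.arr 4 i)
        else σ.arr 4 i) (by intro i; simp) (by
      intro m hm τ hτ hr ha hI i
      have h14 : τ.reg 14 = l := by rw [hr 14 (by omega)]; simp [State.setReg_reg]
      rw [Function.update_apply]
      split_ifs with h1 h2 h3 h4 h5 h6 h7
      all_goals first
        | omega
        | (simp only [eval_cond, T_lt, T_eq, eval_reg, eval_const, eval_load, hτ, h14, hI]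
           subst h1
           simp [*])
        | (rw [hI]; split_ifs <;> omega))
    have h0 : ((σ.setReg 14 l).setReg 6 d).reg 0 = σ.reg 0 := by simp [State.setReg_reg]
    rw [h0] at hfill
    funext i
    refine propext ?_
    rw [maskOf, hfill, maskBit, testBit_succ (l := l) ((hbit l).1 (l2 hln)) (fun i hi => by
        have := l3 i hi
        rw [hbit] at this
        simpa using this)]
    have := hbit i
    rcases lt_trichotomy i l with h | h | h
    · simp [h, h.trans hln]
    · simp [h, hln]
    · have h1 : ¬ i < l := by omega
      have h2 : i ≠ l := by omega
      simp [h1, h2, this]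

end RAM

namespace RAM

open Biclique Exp

/-! ### The complete algorithm -/

/-- The largest number of candidates of a pair of vertices. -/
def lengthExp : Exp :=
  card 20 (ex 11 (ex 12 (and seedExp (lt (reg 20) (card 15 (candExp 15))))))

open Classical in
-- Counting the numbers smaller than some candidate number gives the largest candidate number. The
-- bound by `g` controls the number of masks, and the bound by `n` lets a mask fit into the cells
-- that a loop visits.
theorem eval_lengthExp_le {σ : State} {g : ℕ}
    (h : ∀ v u, IsSeed (relOf σ) (σ.reg 0) v u →
      ((Finset.range (σ.reg 0)).filter (InCandidates (relOf σ) v u)).card ≤ g) :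
    lengthExp.eval σ ≤ g ∧ lengthExp.eval σ ≤ σ.reg 0 ∧
      ∀ v u, IsSeed (relOf σ) (σ.reg 0) v u →
        ((Finset.range (σ.reg 0)).filter (InCandidates (relOf σ) v u)).card ≤ lengthExp.eval σ := by
  have heval : lengthExp.eval σ = countBelow (σ.reg 0) fun m => ∃ v < σ.reg 0, ∃ u < σ.reg 0,
      IsSeed (relOf σ) (σ.reg 0) v u ∧
        m < countBelow (σ.reg 0) (InCandidates (relOf σ) v u) := by
    simp [lengthExp, T_seedExp, T_candExp, State.setReg_reg, relOf_setReg]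
  refine ⟨?_, ?_, fun v u hvu => ?_⟩
  · rw [heval]
    refine countBelow_le_of_lt fun m _ => ?_
    rintro ⟨v, _, u, _, hvu, hlt⟩
    have := h v u hvu
    rw [card_filter_range] at this
    omega
  · rw [heval]
    exact countBelow_le _ _
  · rw [heval, card_filter_range]
    exact le_countBelow (countBelow_le _ _) fun m hm =>
      ⟨v, hvu.1, u, hvu.2.1.trans hvu.1, hvu, hm⟩

def initProg : Prog :=
  .seq orderProg (.seq (.assign 7 lengthExp) (.seq (.assign 6 (const 0))
    (.seq (.assign 8 (const 1)) (.assign 3 (const 0)))))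

def roundProg (e : Exp) : Prog := .seq (searchProg e) nextProg

def finalProg : Prog := .assign 3 (cond (reg 3) (const 1) (const 0))

/-- The algorithm, for the predicate expressed by `e`. -/
def bicliqueCmd (e : Exp) : Cmd :=
  .seq (initProg.compile 64) (.seq (.loop (.lt 6 8) ((roundProg e).compile 64))
    (.seq (finalProg.compile 64) (.copy 0 3)))

theorem Prog.runs_loop {d x y : ℕ} (hd : 0 < d) (hx : x < d) (hy : y < d) {p : Prog} (hp : p.wf d)
    {n : ℕ} (J : ℕ → State → Prop) (K : ℕ) (hn : ∀ k σ, J k σ → σ.reg 0 = n)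
    (hlt : ∀ k < K, ∀ σ, J k σ → σ.reg x < σ.reg y) (hK : ∀ σ, J K σ → ¬ σ.reg x < σ.reg y)
    (hJ : ∀ k < K, ∀ σ, J k σ → J (k + 1) (p.eval σ)) {σ τ : State} (h0 : J 0 σ)
    (hA : Agree d σ τ) :
    Runs (.loop (.lt x y) (p.compile d)) τ (K * (p.cost.eval n + 1) + 1)
      (fun τ => ∃ σ, Agree d σ τ ∧ J K σ) := by
  refine Runs.loop (fun k τ => ∃ σ, Agree d σ τ ∧ J k σ) K ?_ ?_ ?_ ⟨σ, hA, h0⟩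
  · rintro k hk τ ⟨σ, h1, h2⟩
    simpa [Test.Holds, ← h1.2 x hx, ← h1.2 y hy] using hlt k hk σ h2
  · rintro τ ⟨σ, h1, h2⟩
    simpa [Test.Holds, ← h1.2 x hx, ← h1.2 y hy] using hK σ h2
  · rintro k hk τ ⟨σ, h1, h2⟩
    have := Prog.runs_compile hd p hp h1
    rw [hn k σ h2] at this
    exact this.weaken le_rfl fun υ hυ => ⟨_, hυ, hJ k hk σ h2⟩

theorem nextProg_regs : nextProg.regs = [14, 6, 15] := rfl

theorem nextProg_arrs : nextProg.arrs = [4] := rfl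

theorem searchProg_regs (e : Exp) : (searchProg e).regs =
    [11, 12, 15, 15, 13, 4, 5, 3, 4, 5, 3, 15, 15, 13, 4, 5, 3, 4, 5, 3] := rfl

theorem searchProg_arrs (e : Exp) : (searchProg e).arrs = [3, 3, 3, 3] := rfl

theorem wf_roundProg {e : Exp} (he : e.wf 64) : (roundProg e).wf 64 := by
  have h1 : (sidesProg e).wf 64 := by
    have hl : sideTwoExp.wf 64 ∧ sideOneExp.wf 64 := by decide
    simp [sidesProg, Prog.wf, Exp.wf, Exp.cond, Exp.or, he, hl]
  have h2 : (labelProg e).wf 64 := by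
    have hl : (fillProg 15 3 startExp).wf 64 ∧ (fillProg 15 3 extendExp).wf 64 := by decide
    simp [labelProg, Prog.wf, h1, hl, show (sidesProg e).regs = [4, 5, 3] from rfl]
  have h3 : (searchProg e).wf 64 := by
    simp [searchProg, Prog.wf, h2, Prog.regs, labelProg_regs]
  have h4 : nextProg.wf 64 := by decide
  simp only [roundProg, Prog.wf, h3, h4, Bool.and_self]

theorem polynomial_eval_mono (q : Polynomial ℕ) {m n : ℕ} (h : m ≤ n) : q.eval m ≤ q.eval n := by
  rw [Polynomial.eval_eq_sum_range, Polynomial.eval_eq_sum_range]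
  exact Finset.sum_le_sum fun i _ => Nat.mul_le_mul_left _ (Nat.pow_le_pow_left h i)

/-- The state after initialization and `k` rounds. -/
structure RoundInv (P : ℕ → ℕ → Prop) (σ : State) (g k : ℕ) (τ : State) : Prop where
  reg : ∀ y ∈ [0, 1, 2, 7, 8], τ.reg y = σ.reg y
  arr : ∀ a ∈ [0, 1], τ.arr a = σ.arr a
  mask : k < 2 ^ g → maskOf τ = maskBit k
  done : τ.reg 6 = if k < 2 ^ g then 0 else 1
  res : τ.reg 3 ≠ 0 ↔ ∃ j < k,
    (∃ v < σ.reg 0, ∃ u < σ.reg 0, Success (relOf σ) (σ.reg 0) P j v u) ∨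
      Success (relOf σ) (σ.reg 0) P j (σ.reg 0) 0

theorem RoundInv.step {e : Exp} {P : ℕ → ℕ → ℕ → ℕ → Prop} (he : Expresses e P) {σ τ : State}
    {g k : ℕ} (hg : σ.reg 7 = g) (hgn : g ≤ σ.reg 0) (hk : k < 2 ^ g)
    (h : RoundInv (P (σ.reg 1) (σ.reg 2)) σ g k τ) :
    RoundInv (P (σ.reg 1) (σ.reg 2)) σ g (k + 1) ((roundProg e).eval τ) := by
  have hm := h.mask hk
  rw [roundProg, Prog.eval]
  set υ := (searchProg e).eval τ with hυ
  have hr : ∀ y ∈ [0, 1, 2, 7, 8], υ.reg y = σ.reg y := by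
    intro y hy
    rw [hυ, Prog.eval_reg, h.reg y hy]
    rw [searchProg_regs]
    fin_cases hy <;> simp
  have ha : ∀ a ∈ [0, 1, 4], υ.arr a = τ.arr a := by
    intro a ha
    rw [hυ, Prog.eval_arr]
    rw [searchProg_arrs]
    fin_cases ha <;> simp
  have hm' : maskOf υ = maskBit k := by
    rw [← hm]; unfold maskOf; rw [ha 4 (by simp)]
  obtain ⟨n1, n2⟩ := nextProg_spec (σ := υ) (k := k) (g := g) (by rw [hr 7 (by simp), hg])
    (by rw [hr 0 (by simp)]; exact hgn) hk hm'
  refine ⟨fun y hy => ?_, fun a haa => ?_, n2, n1, ?_⟩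
  · rw [Prog.eval_reg, hr y hy]
    rw [nextProg_regs]
    fin_cases hy <;> simp
  · rw [Prog.eval_arr, ha a, h.arr a haa]
    · fin_cases haa <;> simp
    · rw [nextProg_arrs]
      fin_cases haa <;> simp
  · rw [Prog.eval_reg _ _ (by simp [nextProg_regs]), hυ, searchProg_spec he τ hm, h.res,
      h.reg 0 (by simp), h.reg 1 (by simp), h.reg 2 (by simp),
      relOf_congr (h.reg 0 (by simp)) (h.arr 0 (by simp)) (h.arr 1 (by simp))]
    simp only [Nat.lt_succ_iff_lt_or_eq (n := k), or_and_right, exists_or, exists_eq_left]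

theorem bicliqueCmd_spec {e : Exp} (hwf : e.wf 64) {P : ℕ → ℕ → ℕ → ℕ → Prop}
    (he : Expresses e P) (hP : ∀ c d a b, P c d a b → P c d b a)
    (hP' : ∀ c d a b a' b', a ≤ a' → b ≤ b' → P c d a b → P c d a' b')
    {σ : State} {n g : ℕ} {A : ℕ → ℕ → Prop} (hn : σ.reg 0 = n) (hA : matrixRel n (σ.arr 0) = A)
    (hs : ∀ x y, A x y → A y x) (hi : ∀ x, ¬ A x x) (hW : WeaklyClosedOn A n g)
    (h2 : ∀ x, σ.arr 2 x = 0) (h4 : ∀ x, σ.arr 4 x = 0) :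
    ∃ o : ℕ → ℕ, (∀ r < n, o r < n) ∧ (∀ r < n, ∀ s < n, o r = o s → r = s) ∧
      DecidesWithin (bicliqueCmd e) σ (2 ^ g * (initProg.cost + (roundProg e).cost +
        finalProg.cost + 3).eval n)
        (∃ S T : Finset ℕ, S ⊆ Finset.range n ∧ T ⊆ Finset.range n ∧
          (∀ s ∈ S, ∀ t ∈ T, renumber A o s t) ∧ P (σ.reg 1) (σ.reg 2) S.card T.card) := by
  set ρ := orderProg.eval σ with hρ
  have hE : IsElim A n g 0 (ρ.arr 1) := orderProg_spec hn hA hW h2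
  have ρr : ∀ y, y ∉ [10, 11, 16] → ρ.reg y = σ.reg y := fun y hy =>
    Prog.eval_reg _ _ hy
  have ρa : ∀ a, a ∉ [1, 2] → ρ.arr a = σ.arr a := fun a ha =>
    Prog.eval_arr _ _ ha
  have hrel : relOf ρ = renumber A (ρ.arr 1) := by
    rw [relOf, ρr 0 (by simp), ρa 0 (by simp), hn, hA]
  have ρ0 : ρ.reg 0 = n := by rw [ρr 0 (by simp), hn]
  obtain ⟨L1, L2, L3⟩ := eval_lengthExp_le (σ := ρ) (g := g) (fun v u hvu => by
    rw [hrel, ρ0] at hvu ⊢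
    exact hE.card_candidates hvu)
  set m := lengthExp.eval ρ with hm
  set ι := initProg.eval σ with hι
  have hι' : ι = (((ρ.setReg 7 m).setReg 6 0).setReg 8 1).setReg 3 0 := rfl
  have ι0 : ι.reg 0 = n := by rw [hι']; simpa [State.setReg_reg] using ρ0
  have ι1 : ι.reg 1 = σ.reg 1 := by
    rw [hι', ← ρr 1 (by simp)]; simp [State.setReg_reg]
  have ι2 : ι.reg 2 = σ.reg 2 := by
    rw [hι', ← ρr 2 (by simp)]; simp [State.setReg_reg]
  have ι7 : ι.reg 7 = m := by rw [hι']; simp [State.setReg_reg]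
  have ι8 : ι.reg 8 = 1 := by rw [hι']; simp [State.setReg_reg]
  have ιa : ι.arr = ρ.arr := by rw [hι']; rfl
  have ιrel : relOf ι = renumber A (ρ.arr 1) := by
    rw [← hrel]; exact relOf_congr (ι0.trans ρ0.symm) (by rw [ιa]) (by rw [ιa])
  have hI0 : RoundInv (P (ι.reg 1) (ι.reg 2)) ι m 0 ι := by
    refine ⟨fun _ _ => rfl, fun _ _ => rfl, fun _ => ?_, ?_, ?_⟩
    · funext i
      simp [maskOf, maskBit, ιa, ρa 4 (by simp), h4]
    · rw [hι']; simp [State.setReg_reg]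
    · rw [hι']; simp [State.setReg_reg]
  have hrun : Runs (bicliqueCmd e) σ (initProg.cost.eval n +
      ((2 ^ m * ((roundProg e).cost.eval n + 1) + 1) + (finalProg.cost.eval n + 1)))
      (fun τ => ∃ υ, RoundInv (P (ι.reg 1) (ι.reg 2)) ι m (2 ^ m) υ ∧
        τ.reg 0 = if υ.reg 3 ≠ 0 then 1 else 0) := by
    have hinit := Prog.runs_compile (d := 64) (by omega) initProg (by decide) (Agree.refl 64 σ)
    rw [hn] at hinit
    refine hinit.seq fun τ hτ => ?_
    refine Runs.seq (Prog.runs_loop (d := 64) (n := n) (by omega) (by omega) (by omega)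
      (wf_roundProg hwf)
      (RoundInv (P (ι.reg 1) (ι.reg 2)) ι m) (2 ^ m) ?_ ?_ ?_ ?_ hI0 hτ) fun τ' hτ' => ?_
    · intro k υ h
      rw [h.reg 0 (by simp), ι0]
    · intro k hk υ h
      rw [h.done, h.reg 8 (by simp), ι8, if_pos hk]; omega
    · intro υ h
      rw [h.done, h.reg 8 (by simp), ι8, if_neg (lt_irrefl _)]; omega
    · intro k hk υ h
      exact h.step he ι7 (by rw [ι0, ← ρ0]; exact L2) hk
    · obtain ⟨υ, h1, h2⟩ := hτ'
      have hfin := Prog.runs_compile (d := 64) (by omega) finalProg (by decide) h1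
      rw [h2.reg 0 (by simp), ι0] at hfin
      refine hfin.seq fun τ'' h => ⟨1, _, .copy 0 3 τ'', le_rfl, υ, h2, ?_⟩
      rw [State.setReg_reg, if_pos rfl, ← h.2 3 (by omega)]
      simp only [finalProg, Prog.eval, State.setReg_reg, if_true, eval_cond, T_reg, eval_const]
  obtain ⟨t, τ, hexec, ht, υ, hυ, hres⟩ := hrun
  have hiff : υ.reg 3 ≠ 0 ↔ (∃ S T : Finset ℕ, S ⊆ Finset.range n ∧ T ⊆ Finset.range n ∧
      (∀ s ∈ S, ∀ t ∈ T, renumber A (ρ.arr 1) s t) ∧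
      P (σ.reg 1) (σ.reg 2) S.card T.card) := by
    rw [hυ.res, ι0, ι1, ι2, ιrel]
    refine (exists_biclique_iff (fun x y => hs _ _) (fun x => hi _) (hP _ _) (hP' _ _)
      (fun v u hvu => ?_)).symm
    have := L3 v u (by rwa [ρ0, hrel])
    rwa [ρ0, hrel] at this
  refine ⟨ρ.arr 1, fun r hr => hE.lt r (by omega) hr,
    fun r hr s hs' h => hE.inj r s (by omega) hr (by omega) hs' h, t, τ, hexec, ht.trans ?_, ?_, ?_⟩
  -- The mask length `m` is at most `g`, and the polynomial costs outside the loop are absorbed by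
  -- `1 ≤ 2 ^ g`.
  · have h1 : 2 ^ m ≤ 2 ^ g := Nat.pow_le_pow_right two_pos L1
    have h2 : 1 ≤ 2 ^ g := Nat.one_le_two_pow
    simp only [Polynomial.eval_add, Polynomial.eval_ofNat]
    have h3 := Nat.mul_le_mul_right ((roundProg e).cost.eval n + 1) h1
    have h4 := Nat.mul_le_mul_right (initProg.cost.eval n + finalProg.cost.eval n + 2) h2
    linarith
  · intro h
    rw [hres, if_pos (hiff.2 h)]
  · intro h
    rw [hres, if_neg fun h' => h (hiff.1 h')]

/-! ### Weak closure -/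

theorem card_filter_fin {n : ℕ} (p : Fin n → Prop) [DecidablePred p] :
    (Finset.univ.filter p).card = countBelow n fun w => ∃ h : w < n, p ⟨w, h⟩ := by
  rw [countBelow, ← Finset.card_map Fin.valEmbedding]
  congr 1
  ext w
  simp only [Finset.mem_map, Finset.mem_filter, Finset.mem_univ, true_and, Fin.valEmbedding_apply,
    Finset.mem_range]
  constructor
  · rintro ⟨i, hi, rfl⟩
    exact ⟨i.2, i.2, hi⟩
  · rintro ⟨-, h, hp⟩
    exact ⟨_, hp, rfl⟩

theorem closureNumber_bound {V : Type*} [Finite V] (G : SimpleGraph V) {v u : V} (huv : u ≠ v)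
    (h : ¬ G.Adj v u) : (G.commonNeighbors v u).ncard ≤ closureNumber G v := by
  refine le_csSup ⟨Nat.card V, ?_⟩ ⟨u, huv, h, rfl⟩
  rintro m ⟨u, -, -, rfl⟩
  exact Set.ncard_le_card _

/-- The infimum is attained because `n + 1` is admissible: no closure number exceeds `n`. -/
theorem isWeaklyClosed_weakClosure {n : ℕ} (G : SimpleGraph (Fin n)) :
    IsWeaklyClosed G (weakClosure G) := by
  refine Nat.sInf_mem (s := {g | IsWeaklyClosed G g}) ⟨n + 1, ?_⟩
  rintro X ⟨x, hx⟩
  refine ⟨⟨x, hx⟩, Nat.lt_succ_of_le ?_⟩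
  have : (Nat.card X) ≤ n := by
    simpa using Nat.card_le_card_of_injective (Subtype.val : X → Fin n) Subtype.val_injective
  refine csSup_le' ?_
  rintro m ⟨u, -, -, rfl⟩
  exact (Set.ncard_le_card _).trans this

/-- The adjacency relation of `G` on natural numbers. -/
def natAdj {n : ℕ} (G : SimpleGraph (Fin n)) (x y : ℕ) : Prop :=
  ∃ (hx : x < n) (hy : y < n), G.Adj ⟨x, hx⟩ ⟨y, hy⟩

theorem matrixRel_graphInput {n : ℕ} (G : SimpleGraph (Fin n)) (ks : List ℕ) :
    matrixRel n ((graphInput G ks).arr 0) = natAdj G := by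
  funext x y
  refine propext ?_
  constructor
  · rintro ⟨hx, hy, h⟩
    simp only [graphInput, ne_eq, ite_eq_right_iff, true_and, Nat.one_ne_zero, imp_false,
      not_not] at h
    obtain ⟨i, j, hij, hadj⟩ := h
    have hn : 0 < n := by omega
    have h1 : x = i := by
      have := congrArg (· / n) hij
      simpa [Nat.add_div_of_dvd_right, Nat.div_eq_of_lt hy, Nat.div_eq_of_lt j.2, hn] using this
    have h2 : y = j := by rw [h1] at hij; omega
    subst h1 h2
    exact ⟨hx, hy, hadj⟩
  · rintro ⟨hx, hy, h⟩
    refine ⟨hx, hy, ?_⟩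
    simp only [graphInput]
    rw [if_pos ⟨rfl, _, _, rfl, h⟩]
    exact one_ne_zero

theorem weaklyClosedOn_natAdj {n : ℕ} (G : SimpleGraph (Fin n)) :
    WeaklyClosedOn (natAdj G) n (weakClosure G) := by
  classical
  rintro L ⟨x, hx, hLx⟩
  obtain ⟨v, hv⟩ := isWeaklyClosed_weakClosure G {i | L i} ⟨⟨x, hx⟩, hLx⟩
  refine ⟨v.1, v.1.2, v.2, fun u hu hLu huv hadj => ?_⟩
  let u' : {i : Fin n | L i} := ⟨⟨u, hu⟩, hLu⟩
  refine lt_of_le_of_lt ?_ ((closureNumber_bound (G.induce {i : Fin n | L i}) (v := v)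
    (u := u') ?_ ?_).trans_lt hv)
  · rw [← Set.ncard_image_of_injective _ Subtype.val_injective, commonCount]
    have : (Subtype.val '' (G.induce {i : Fin n | L i}).commonNeighbors v u') =
        ((Finset.univ.filter fun w : Fin n => L w ∧ G.Adj v w ∧ G.Adj ⟨u, hu⟩ w : Finset (Fin n)) :
          Set (Fin n)) := by
      ext w
      simp only [Set.mem_image, Finset.coe_filter, Finset.mem_univ, true_and, Set.mem_ofPred_eq,
        SimpleGraph.mem_commonNeighbors, SimpleGraph.comap_adj, Function.Embedding.subtype_apply]
      constructor
      · rintro ⟨w, ⟨h1, h2⟩, rfl⟩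
        exact ⟨w.2, h1, h2⟩
      · rintro ⟨h1, h2, h3⟩
        exact ⟨⟨w, h1⟩, ⟨h2, h3⟩, rfl⟩
    rw [this, Set.ncard_coe_finset, card_filter_fin]
    refine (countBelow_congr fun k hk => ?_).le
    constructor
    · rintro ⟨h1, ⟨_, _, h2⟩, ⟨_, _, h3⟩⟩
      exact ⟨hk, h1, h2, h3⟩
    · rintro ⟨_, h1, h2, h3⟩
      exact ⟨h1, ⟨_, _, h2⟩, ⟨_, _, h3⟩⟩
  · intro h
    exact huv (congrArg (fun w : {i : Fin n | L i} => (w.1 : ℕ)) h)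
  · intro h
    exact hadj ⟨v.1.2, hu, h⟩

/-- An injective renumbering of a finite set is a bijection, so it preserves sizes. Disjointness
follows from irreflexivity of adjacency. -/
theorem exists_biclique_renumber_iff {n : ℕ} (G : SimpleGraph (Fin n)) {o : ℕ → ℕ}
    (ho : ∀ r < n, o r < n) (hinj : ∀ r < n, ∀ s < n, o r = o s → r = s) (P : ℕ → ℕ → Prop) :
    (∃ S T : Finset ℕ, S ⊆ Finset.range n ∧ T ⊆ Finset.range n ∧
      (∀ s ∈ S, ∀ t ∈ T, renumber (natAdj G) o s t) ∧ P S.card T.card) ↔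
    ∃ S T : Finset (Fin n), Disjoint S T ∧ P S.card T.card ∧ ∀ s ∈ S, ∀ t ∈ T, G.Adj s t := by
  let f : Fin n ↪ Fin n := ⟨fun i => ⟨o i, ho i i.2⟩, fun i j h => Fin.ext
    (hinj i i.2 j j.2 (congrArg Fin.val h))⟩
  constructor
  · rintro ⟨S, T, hS, hT, hST, hP⟩
    have hS' : ∀ x ∈ S, x < n := fun x hx => Finset.mem_range.1 (hS hx)
    have hT' : ∀ x ∈ T, x < n := fun x hx => Finset.mem_range.1 (hT hx)
    have hadj : ∀ s ∈ (S.attachFin hS').map f, ∀ t ∈ (T.attachFin hT').map f, G.Adj s t := by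
      intro s hs t ht
      obtain ⟨i, hi, rfl⟩ := Finset.mem_map.1 hs
      obtain ⟨j, hj, rfl⟩ := Finset.mem_map.1 ht
      obtain ⟨_, _, h⟩ := hST i (by simpa using hi) j (by simpa using hj)
      exact h
    refine ⟨_, _, Finset.disjoint_left.2 fun x h h' => G.irrefl (hadj x h x h'), ?_, hadj⟩
    simpa using hP
  · rintro ⟨S, T, -, hP, hST⟩
    let φ : Fin n ≃ Fin n := Equiv.ofBijective f (Finite.injective_iff_bijective.1 f.injective)
    have hsub : ∀ U : Finset (Fin n), (U.map φ.symm.toEmbedding).map Fin.valEmbedding ⊆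
        Finset.range n := by
      intro U x hx
      obtain ⟨i, -, rfl⟩ := Finset.mem_map.1 hx
      exact Finset.mem_range.2 i.2
    refine ⟨(S.map φ.symm.toEmbedding).map Fin.valEmbedding,
      (T.map φ.symm.toEmbedding).map Fin.valEmbedding, hsub S, hsub T, ?_, by simpa using hP⟩
    intro s hs t ht
    simp only [Finset.mem_map, Equiv.coe_toEmbedding, Fin.valEmbedding_apply,
      exists_exists_and_eq_and] at hs ht
    obtain ⟨i, hi, rfl⟩ := hs
    obtain ⟨j, hj, rfl⟩ := ht
    refine ⟨ho _ (φ.symm i).2, ho _ (φ.symm j).2, ?_⟩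
    have h := hST i hi j hj
    rw [← φ.apply_symm_apply i, ← φ.apply_symm_apply j] at h
    exact h

theorem exists_cmd_biclique {e : Exp} (hwf : e.wf 64) {P : ℕ → ℕ → ℕ → ℕ → Prop}
    (he : Expresses e P) (hP : ∀ c d a b, P c d a b → P c d b a)
    (hP' : ∀ c d a b a' b', a ≤ a' → b ≤ b' → P c d a b → P c d a' b') :
    ∃ (p : Cmd) (q : Polynomial ℕ), ∀ (n : ℕ) (G : SimpleGraph (Fin n)) (ks : List ℕ),
      DecidesWithin p (graphInput G ks) (2 ^ weakClosure G * q.eval (inputSize n ks))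
        (∃ S T : Finset (Fin n), Disjoint S T ∧ P (ks.getD 0 0) (ks.getD 1 0) S.card T.card ∧
          ∀ s ∈ S, ∀ t ∈ T, G.Adj s t) := by
  refine ⟨bicliqueCmd e, initProg.cost + (roundProg e).cost + finalProg.cost + 3, fun n G ks => ?_⟩
  obtain ⟨o, ho, hinj, t, σ', h1, h2, h3, h4⟩ := bicliqueCmd_spec hwf he hP hP'
    (σ := graphInput G ks) (n := n) rfl (matrixRel_graphInput G ks)
    (fun x y ⟨hx, hy, h⟩ => ⟨hy, hx, h.symm⟩) (fun x ⟨_, _, h⟩ => G.irrefl h)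
    (weaklyClosedOn_natAdj G) (fun x => by simp [graphInput]) (fun x => by simp [graphInput])
  rw [exists_biclique_renumber_iff G ho hinj] at h3 h4
  refine ⟨t, σ', h1, h2.trans (Nat.mul_le_mul_left _ (polynomial_eval_mono _ ?_)), h3, h4⟩
  -- The cost is a polynomial in `n`, and `n ≤ n * n` is at most the input size.
  have := Nat.le_mul_self n
  unfold inputSize
  omega

/-! ### The size conditions of the two problems -/

/-- The expression for the sizes of the sides, in one order or the other. -/
def sizesExp : Exp :=
  or (and (neg (lt (reg 4) (reg 1))) (neg (lt (reg 5) (reg 2))))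
    (and (neg (lt (reg 5) (reg 1))) (neg (lt (reg 4) (reg 2))))

theorem expresses_sizesExp :
    Expresses sizesExp fun c d a b => (c ≤ a ∧ d ≤ b) ∨ (c ≤ b ∧ d ≤ a) := by
  intro σ _ _
  simp [sizesExp]

/-- The expression for the product of the sizes of the sides. -/
def productExp : Exp :=
  neg (lt (sum 15 (cond (lt (reg 15) (reg 4)) (reg 5) (const 0))) (reg 1))

theorem expresses_productExp : Expresses productExp fun c _ a b => c ≤ a * b := by
  intro σ h4 h5
  -- The product is a repeated sum; the range and the cap at `n` lose nothing because both sizes are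
  -- at most `n`.
  have : (sum 15 (cond (lt (reg 15) (reg 4)) (reg 5) (const 0))).eval σ = σ.reg 4 * σ.reg 5 := by
    have hrange : (Finset.range (σ.reg 0)).filter (fun k => k < σ.reg 4) =
        Finset.range (σ.reg 4) := by
      ext k; simp; omega
    rw [Exp.eval, Finset.sum_congr rfl (g := fun k => if k < σ.reg 4 then σ.reg 5 else 0),
      ← Finset.sum_filter, Finset.sum_const, smul_eq_mul, hrange, Finset.card_range]
    intro k _
    simp only [eval_cond, T_lt, eval_reg, eval_const, State.setReg_reg]
    split_ifs <;> simp_all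
  simp [productExp, this]

end RAM

theorem mainTheorem7 :
    (∃ (p : RAM.Cmd) (q : Polynomial ℕ), ∀ (n : ℕ) (G : SimpleGraph (Fin n)) (k₁ k₂ : ℕ),
      RAM.DecidesWithin p (RAM.graphInput G [k₁, k₂])
        (2 ^ weakClosure G * q.eval (RAM.inputSize n [k₁, k₂]))
        (HasNonInducedBiclique G k₁ k₂)) ∧
    (∃ (p : RAM.Cmd) (q : Polynomial ℕ), ∀ (n : ℕ) (G : SimpleGraph (Fin n)) (k : ℕ),
      RAM.DecidesWithin p (RAM.graphInput G [k])
        (2 ^ weakClosure G * q.eval (RAM.inputSize n [k]))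
        (HasNonInducedMaxEdgeBiclique G k)) := by
  constructor
  · obtain ⟨p, q, h⟩ := RAM.exists_cmd_biclique (by decide) RAM.expresses_sizesExp
      (fun c d a b h => h.symm.imp id id) (fun c d a b a' b' h1 h2 h => by omega)
    refine ⟨p, q, fun n G k₁ k₂ => ?_⟩
    -- The search needs a symmetric condition; exchanging `S` and `T` shows that symmetrizing does
    -- not change the answer.
    have hiff : HasNonInducedBiclique G k₁ k₂ ↔ ∃ S T : Finset (Fin n), Disjoint S T ∧
        ((k₁ ≤ S.card ∧ k₂ ≤ T.card) ∨ (k₁ ≤ T.card ∧ k₂ ≤ S.card)) ∧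
        ∀ s ∈ S, ∀ t ∈ T, G.Adj s t := by
      constructor
      · rintro ⟨S, T, h1, h2, h3, h4⟩
        exact ⟨S, T, h1, .inl ⟨h2, h3⟩, h4⟩
      · rintro ⟨S, T, h1, h2 | h2, h4⟩
        · exact ⟨S, T, h1, h2.1, h2.2, h4⟩
        · exact ⟨T, S, h1.symm, h2.1, h2.2, fun s hs t ht => (h4 t ht s hs).symm⟩
    rw [hiff]
    exact h n G [k₁, k₂]
  · obtain ⟨p, q, h⟩ := RAM.exists_cmd_biclique (by decide) RAM.expresses_productExp
      (fun c d a b h => by rwa [mul_comm])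
      (fun c d a b a' b' h1 h2 h => h.trans (Nat.mul_le_mul h1 h2))
    exact ⟨p, q, fun n G k => h n G [k]⟩
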